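/- Let $d,N\in\mathbb N$, let $P$ be a non-zero germ of a holomorphic function at $0\in\mathbb C^d$ with $P(0)=0$, let $a_1,\dots,a_d$ be germs of holomorphic functions at $0\in\mathbb C^d$, not all identically zero, and put $L=a_1(x)\partial_{x_1}+\cdots+a_d(x)\partial_{x_d}$. Let $F$ be a $\mathbb C^N$-valued holomorphic map defined near $(0,0)\in\mathbb C^d\times\mathbb C^N$ such that $F(0,0)=0$ and the matrix $\mu=\frac{\partial F}{\partial y}(0,0)$ is invertible. Suppose that $P$ divides $L(P)$ in the ring of germs of holomorphic functions at $0\in\mathbb C^d$. Then the system of partial differential equations $$P(x)\,L(y)(x)=F(x,y)$$ has a unique formal power series solution $\hat y\in\mathbb C[[x_1,\dots,x_d]]^N$ with $\hat y(0)=0$. Moreover, $\hat y$ is $P$-$1$-Gevrey: there are a polydisc $D=\{x\in\mathbb C^d: |x_j|<r_j,\ j=1,\dots,d\}$ with all $r_j>0$, constants $C,A>0$, and holomorphic maps $y_n:D\to\mathbb C^N$ $(n\ge 0)$ such that, as formal power series, $$\hat y=\sum_{n=0}^\infty y_nP^n\qquad\text{and}\qquad \sup_{x\in D}|y_n(x)|\le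 C A^n\, n!\quad\text{for all } n\ge 0 .$$ -/

import Mathlib

open Topology

noncomputable section

/-- The mixed partial derivative at the origin `∂^β f (0)` of a function of the complex variables
`(x_i)_{i ∈ ι}`: the iterated Fréchet derivative of order `|β|`, evaluated on the standard basis
vectors `e_i`, each of them repeated `β i` times. -/
def mixedPartialAtZero {ι : Type*} [Fintype ι] [DecidableEq ι]
    (f : (ι → ℂ) → ℂ) (β : ι →₀ ℕ) : ℂ :=
  iteratedFDeriv ℂ β.toMultiset.toList.length f 0
    (fun k => Pi.single (β.toMultiset.toList.get k) 1)

/-- The Taylor series at the origin, `∑_β (∂^β f (0) / β!) x^β`. -/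
def taylorSeries {ι : Type*} [Fintype ι] [DecidableEq ι]
    (f : (ι → ℂ) → ℂ) : MvPowerSeries ι ℂ :=
  fun β => mixedPartialAtZero f β / ((∏ i, (β i).factorial : ℕ) : ℂ)

/-- The partial derivative `∂f/∂x_j` of a function of `d` complex variables. -/
def partialDeriv {d : ℕ} (j : Fin d) (f : (Fin d → ℂ) → ℂ) (x : Fin d → ℂ) : ℂ :=
  fderiv ℂ f x (Pi.single j 1)

/-- The vector field `L = ∑_j a_j ∂_{x_j}` applied to a function. -/
def applyField {d : ℕ} (a : Fin d → (Fin d → ℂ) → ℂ) (f : (Fin d → ℂ) → ℂ)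
    (x : Fin d → ℂ) : ℂ :=
  ∑ j, a j x * partialDeriv j f x

/-- The vector field `L = ∑_j a_j ∂_{x_j}` applied to a formal power series. -/
def formalField {d : ℕ} (a : Fin d → (Fin d → ℂ) → ℂ) (g : MvPowerSeries (Fin d) ℂ) :
    MvPowerSeries (Fin d) ℂ :=
  ∑ j, taylorSeries (a j) * MvPowerSeries.pderiv ℂ j g

/-- `f` divides `g` in the ring of germs at the origin of holomorphic functions. -/
def GermDvd {d : ℕ} (f g : (Fin d → ℂ) → ℂ) : Prop :=
  ∃ h : (Fin d → ℂ) → ℂ, AnalyticAt ℂ h 0 ∧ ∀ᶠ x in 𝓝 (0 : Fin d → ℂ), g x = f x * h x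

/-- The Jacobian matrix `∂F/∂y (0, 0)`. -/
def jacobianY {d N : ℕ} (F : (Fin d → ℂ) × (Fin N → ℂ) → (Fin N → ℂ)) :
    Matrix (Fin N) (Fin N) ℂ :=
  Matrix.of fun i j => fderiv ℂ (fun y : Fin N → ℂ => F (0, y)) 0 (Pi.single j 1) i

/-- The Taylor series at the origin of the `i`-th component of `F`, in the variables `x_1, …, x_d`
(left summand) and `y_1, …, y_N` (right summand). -/
def taylorSeriesXY {d N : ℕ} (F : (Fin d → ℂ) × (Fin N → ℂ) → (Fin N → ℂ)) (i : Fin N) :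
    MvPowerSeries (Fin d ⊕ Fin N) ℂ :=
  taylorSeries fun z : Fin d ⊕ Fin N → ℂ => F (fun j => z (Sum.inl j), fun k => z (Sum.inr k)) i

/-- The formal power series `F_i(x, y(x))`, for `y` a vector of power series without constant
terms. -/
def formalComp {d N : ℕ} (F : (Fin d → ℂ) × (Fin N → ℂ) → (Fin N → ℂ))
    (y : Fin N → MvPowerSeries (Fin d) ℂ) (i : Fin N) : MvPowerSeries (Fin d) ℂ :=
  MvPowerSeries.subst (Sum.elim (fun j => MvPowerSeries.X j) y) (taylorSeriesXY F i)

/-- `y` is a formal power series solution of `P · L(y) = F(x, y)`. The constant terms vanish, as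
they have to for the substitution of `y` in the germ `F` at `(0, 0)` to make sense. -/
structure IsFormalSolution {d N : ℕ} (P : (Fin d → ℂ) → ℂ) (a : Fin d → (Fin d → ℂ) → ℂ)
    (F : (Fin d → ℂ) × (Fin N → ℂ) → (Fin N → ℂ))
    (y : Fin N → MvPowerSeries (Fin d) ℂ) : Prop where
  constantCoeff_eq_zero : ∀ i, MvPowerSeries.constantCoeff (y i) = 0
  eq : ∀ i, taylorSeries P * formalField a (y i) = formalComp F y i

/-- The open polydisc centred at the origin with polyradius `r`. -/
def polydisc {d : ℕ} (r : Fin d → ℝ) : Set (Fin d → ℂ) :=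
  {x | ∀ j, ‖x j‖ < r j}

/-- The vector `f` of formal power series is `P`-`s`-Gevrey: `f = ∑_n g_n P^n` with `g_n`
holomorphic on a common polydisc `D` and `sup_D |g_n| ≤ C A^n n!^s`. Here `P(0) = 0`, and the
series is one of formal power series: in each coefficient only finitely many terms are nonzero. -/
def IsGevreyInGerm {d N : ℕ} (P : (Fin d → ℂ) → ℂ) (s : ℝ)
    (f : Fin N → MvPowerSeries (Fin d) ℂ) : Prop :=
  ∃ (r : Fin d → ℝ) (C A : ℝ) (g : ℕ → (Fin d → ℂ) → (Fin N → ℂ)),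
    (∀ j, 0 < r j) ∧ 0 < C ∧ 0 < A ∧
    (∀ n, DifferentiableOn ℂ (g n) (polydisc r)) ∧
    (∀ n, ∀ x ∈ polydisc r, ‖g n x‖ ≤ C * A ^ n * (n.factorial : ℝ) ^ s) ∧
    ∀ (i : Fin N) (β : Fin d →₀ ℕ),
      HasSum (fun n => MvPowerSeries.coeff β
          (taylorSeries (fun x => g n x i) * taylorSeries P ^ n))
        (MvPowerSeries.coeff β (f i))

end

/-!
The idea is to adjoin a variable `t` that stands for `P(x)`. If `L(P) = h P`, then substituting
`t = P(x)` in a power series `Y(x, t)` carries the operator `t (L + h t ∂_t)` to `P L`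
(`substTime_liftedField`). It therefore suffices to solve the regular equation
`t (L + h t ∂_t) Y = F(x, Y)` in `ℂ[[x, t]]`; the coefficients `y_n` of `Y = ∑ y_n t^n` are
then those of the expansion of the solution in powers of `P`, and no division by `P` is needed.

Write `F(x, y) = μ y + G(x, y)`. The lifted equation is the fixed point equation
`Y = μ⁻¹ (t (L + h t ∂_t) Y - G(x, Y))`. If `x_j` has weight `1` and `t` has weight `2`, its right
hand side is contracting for the order filtration, so that the iterates stabilize coefficientwise
(`exists_fixedPoint_of_contracting`). The Gevrey estimate comes from the norm
`∑ |Y_{α,n}| ρ^k T^n k! / (n + k)!`, `k = |α|`: it is submultiplicative (`gevreyWeight_add_le`), and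
`t ∂_{x_j}` and `t² ∂_t` are bounded with norms `T / ρ` and `T`. Hence for small `T` and `ρ` a ball
is preserved by the iteration, and the limit lies in it (`exists_gevrey_fixedPoint`). As
`(n + k)! ≤ 2^(n+k) n! k!`, this bounds the `y_n` on a polydisc by `C A^n n!`
(`wnorm_timeCoeff_le`).

Uniqueness (`fixedPoint_unique`): if two solutions agree to order `k`, their difference `u`
satisfies `u ≡ (μ⁻¹ P L)^s u` to order `k + 1` for all `s`. The right hand side is divisible by
`P^s`, again because `P` divides `L(P)`, so that `u` has order at least `k + 1`.

The passage between germs and formal power series rests on two facts about Taylor series: they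
commute with products and partial derivatives (`taylorSeries_mul`, `pderiv_taylorSeries`), and a
convergent power series is the Taylor series of its sum
(`ConvergesBelow.taylorSeries_evalSeries`).
-/

open MvPowerSeries
open scoped ENNReal NNReal

noncomputable section

namespace GermGevrey

/-! ### Weighted `ℓ¹` norms of formal power series -/

/-- The weighted `ℓ¹` norm `∑_γ w(γ) |f_γ|` of a formal power series, with values in `[0, ∞]`. -/
def wnorm {σ : Type*} (w : (σ →₀ ℕ) → ℝ≥0) (f : MvPowerSeries σ ℂ) : ℝ≥0∞ :=
  ∑' γ, (w γ : ℝ≥0∞) * ‖coeff γ f‖ₑ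

section wnorm

variable {σ τ : Type*} {w : (σ →₀ ℕ) → ℝ≥0}

lemma wnorm_zero : wnorm w (0 : MvPowerSeries σ ℂ) = 0 := by
  simp [wnorm]

lemma wnorm_add_le (f g : MvPowerSeries σ ℂ) : wnorm w (f + g) ≤ wnorm w f + wnorm w g := by
  rw [wnorm, wnorm, wnorm, ← ENNReal.tsum_add]
  refine ENNReal.tsum_le_tsum fun γ => ?_
  rw [← mul_add, map_add]
  gcongr
  exact enorm_add_le _ _

lemma wnorm_neg (f : MvPowerSeries σ ℂ) : wnorm w (-f) = wnorm w f := by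
  simp [wnorm]

lemma wnorm_sub_le (f g : MvPowerSeries σ ℂ) : wnorm w (f - g) ≤ wnorm w f + wnorm w g := by
  rw [sub_eq_add_neg, ← wnorm_neg g]
  exact wnorm_add_le _ _

lemma wnorm_sum_le {ι : Type*} (s : Finset ι) (f : ι → MvPowerSeries σ ℂ) :
    wnorm w (∑ i ∈ s, f i) ≤ ∑ i ∈ s, wnorm w (f i) := by
  classical
  induction s using Finset.induction_on with
  | empty => simp [wnorm_zero]
  | insert i s hi ih =>
    rw [Finset.sum_insert hi, Finset.sum_insert hi]
    exact (wnorm_add_le _ _).trans (by gcongr)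

lemma wnorm_smul (c : ℂ) (f : MvPowerSeries σ ℂ) : wnorm w (c • f) = ‖c‖ₑ * wnorm w f := by
  simp only [wnorm, map_smul, smul_eq_mul, enorm_mul, ← ENNReal.tsum_mul_left]
  exact tsum_congr fun γ => by ring

lemma wnorm_mono {w' : (σ →₀ ℕ) → ℝ≥0} (h : ∀ γ, w γ ≤ w' γ) (f : MvPowerSeries σ ℂ) :
    wnorm w f ≤ wnorm w' f := by
  exact ENNReal.tsum_le_tsum fun γ => mul_le_mul_left (by exact_mod_cast h γ) _

lemma wnorm_monomial (γ : σ →₀ ℕ) (c : ℂ) :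
    wnorm w (monomial γ c) = w γ * ‖c‖ₑ := by
  classical
  rw [wnorm, tsum_eq_single γ]
  · simp
  · intro δ hδ
    simp [coeff_monomial_ne hδ]

lemma wnorm_X (s : σ) : wnorm w (X s) = w (Finsupp.single s 1) := by
  rw [X, wnorm_monomial]
  simp

lemma wnorm_one : wnorm w (1 : MvPowerSeries σ ℂ) = w 0 := by
  rw [← monomial_zero_one, wnorm_monomial]
  simp

/-- For a submultiplicative weight the weighted `ℓ¹` norm is submultiplicative. -/
lemma wnorm_mul_le (hw : ∀ γ δ, w (γ + δ) ≤ w γ * w δ) (f g : MvPowerSeries σ ℂ) :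
    wnorm w (f * g) ≤ wnorm w f * wnorm w g := by
  classical
  have key : wnorm w f * wnorm w g =
      ∑' n, ∑ p ∈ Finset.HasAntidiagonal.antidiagonal n,
        ((w p.1 : ℝ≥0∞) * ‖coeff p.1 f‖ₑ) * ((w p.2 : ℝ≥0∞) * ‖coeff p.2 g‖ₑ) := by
    rw [wnorm, wnorm, ← ENNReal.tsum_mul_right]
    simp_rw [← ENNReal.tsum_mul_left]
    rw [← ENNReal.tsum_prod,
      ← (Finset.HasAntidiagonal.sigmaAntidiagonalEquivProd (A := σ →₀ ℕ)).tsum_eq,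
      ENNReal.tsum_sigma']
    refine tsum_congr fun n => ?_
    rw [← Finset.tsum_subtype]
    rfl
  rw [key]
  refine ENNReal.tsum_le_tsum fun n => ?_
  rw [coeff_mul]
  refine (mul_le_mul_right (enorm_sum_le _ _) _).trans ?_
  rw [Finset.mul_sum]
  refine Finset.sum_le_sum fun p hp => ?_
  rw [Finset.HasAntidiagonal.mem_antidiagonal] at hp
  rw [enorm_mul, ← hp]
  calc (w (p.1 + p.2) : ℝ≥0∞) * (‖coeff p.1 f‖ₑ * ‖coeff p.2 g‖ₑ)
      ≤ ((w p.1 * w p.2 : ℝ≥0) : ℝ≥0∞) * (‖coeff p.1 f‖ₑ * ‖coeff p.2 g‖ₑ) := by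
        gcongr
        exact hw _ _
    _ = _ := by
        rw [ENNReal.coe_mul]
        ring

lemma wnorm_pow_le (hw : ∀ γ δ, w (γ + δ) ≤ w γ * w δ) (hw0 : w 0 ≤ 1)
    (f : MvPowerSeries σ ℂ) (n : ℕ) : wnorm w (f ^ n) ≤ wnorm w f ^ n := by
  induction n with
  | zero => simpa [wnorm_one] using hw0
  | succ n ih =>
    rw [pow_succ, pow_succ]
    exact (wnorm_mul_le hw _ _).trans (by gcongr)

lemma wnorm_prod_le (hw : ∀ γ δ, w (γ + δ) ≤ w γ * w δ) (hw0 : w 0 ≤ 1) {ι : Type*}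
    (s : Finset ι) (f : ι → MvPowerSeries σ ℂ) :
    wnorm w (∏ i ∈ s, f i) ≤ ∏ i ∈ s, wnorm w (f i) := by
  classical
  induction s using Finset.induction_on with
  | empty => simpa [wnorm_one] using hw0
  | insert i s hi ih =>
    rw [Finset.prod_insert hi, Finset.prod_insert hi]
    exact (wnorm_mul_le hw _ _).trans (by gcongr)

lemma wnorm_X_mul_le {w' : (σ →₀ ℕ) → ℝ≥0} {s : σ} {c : ℝ≥0}
    (h : ∀ γ, w (γ + Finsupp.single s 1) ≤ c * w' γ) (f : MvPowerSeries σ ℂ) :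
    wnorm w (X s * f) ≤ c * wnorm w' f := by
  classical
  have inj : Function.Injective fun γ : σ →₀ ℕ => γ + Finsupp.single s 1 :=
    add_left_injective _
  rw [wnorm, ← inj.tsum_eq, wnorm, ← ENNReal.tsum_mul_left]
  · refine ENNReal.tsum_le_tsum fun γ => ?_
    rw [mul_comm (X s), ← mul_assoc, ← ENNReal.coe_mul]
    have := coeff_add_mul_monomial γ (Finsupp.single s 1) f (1 : ℂ)
    rw [mul_one] at this
    rw [X, this]
    gcongr
    exact h γ
  · intro γ hγ
    by_contra hn
    apply hγ
    have : coeff γ (X s * f) = 0 := by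
      rw [X, coeff_monomial_mul, if_neg]
      intro hle
      exact hn ⟨γ - Finsupp.single s 1, tsub_add_cancel_of_le hle⟩
    simp [this]

/-- A change of the weight that absorbs the factor `γ_s` and the shift of the exponent bounds the
partial derivative. -/
lemma wnorm_pderiv_le {w' : (σ →₀ ℕ) → ℝ≥0} {s : σ} {c : ℝ≥0}
    (h : ∀ γ : σ →₀ ℕ, w γ * (γ s + 1) ≤ c * w' (γ + Finsupp.single s 1))
    (f : MvPowerSeries σ ℂ) :
    wnorm w (pderiv ℂ s f) ≤ c * wnorm w' f := by
  classical
  have inj : Function.Injective fun γ : σ →₀ ℕ => γ + Finsupp.single s 1 :=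
    add_left_injective _
  calc wnorm w (pderiv ℂ s f)
      ≤ ∑' γ : σ →₀ ℕ, (c : ℝ≥0∞) * ((w' (γ + Finsupp.single s 1) : ℝ≥0∞) *
          ‖coeff (γ + Finsupp.single s 1) f‖ₑ) := by
        refine ENNReal.tsum_le_tsum fun γ => ?_
        have e : ‖((γ s : ℂ) + 1)‖ₑ = ((γ s + 1 : ℝ≥0) : ℝ≥0∞) := by
          rw [← Nat.cast_succ, ← Nat.cast_succ, enorm_eq_nnnorm, Complex.nnnorm_natCast]
        rw [coeff_pderiv, enorm_mul, e, mul_comm ‖_‖ₑ, ← mul_assoc, ← mul_assoc, ← ENNReal.coe_mul,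
          ← ENNReal.coe_mul]
        exact mul_le_mul_left (by exact_mod_cast h γ) _
    _ = c * ∑' γ : σ →₀ ℕ, ((w' (γ + Finsupp.single s 1) : ℝ≥0∞) *
          ‖coeff (γ + Finsupp.single s 1) f‖ₑ) := ENNReal.tsum_mul_left
    _ ≤ _ := by
        gcongr
        exact ENNReal.tsum_comp_le_tsum_of_injective inj
          (fun γ => (w' γ : ℝ≥0∞) * ‖coeff γ f‖ₑ)

/-- The substitution of power series `a_s` in `f` is majorized by the substitution of the norms of
the `a_s` in the series of absolute values of `f`. -/
lemma wnorm_subst_le (hw : ∀ γ δ, w (γ + δ) ≤ w γ * w δ) (hw0 : w 0 ≤ 1)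
    {a : τ → MvPowerSeries σ ℂ} (ha : HasSubst a) (f : MvPowerSeries τ ℂ) :
    wnorm w (subst a f) ≤ ∑' γ : τ →₀ ℕ, ‖coeff γ f‖ₑ * γ.prod fun s e => wnorm w (a s) ^ e := by
  have h1 : ∀ β, ‖coeff β (subst a f)‖ₑ ≤
      ∑' γ : τ →₀ ℕ, ‖coeff γ f‖ₑ * ‖coeff β (γ.prod fun s e => a s ^ e)‖ₑ := by
    intro β
    rw [coeff_subst ha, finsum_eq_sum _ (coeff_subst_finite ha f β)]
    refine (enorm_sum_le _ _).trans ?_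
    simp only [smul_eq_mul, enorm_mul]
    exact ENNReal.sum_le_tsum _
  calc wnorm w (subst a f)
      ≤ ∑' β, (w β : ℝ≥0∞) *
          ∑' γ : τ →₀ ℕ, ‖coeff γ f‖ₑ * ‖coeff β (γ.prod fun s e => a s ^ e)‖ₑ :=
        ENNReal.tsum_le_tsum fun β => by gcongr; exact h1 β
    _ = ∑' γ : τ →₀ ℕ, ‖coeff γ f‖ₑ * wnorm w (γ.prod fun s e => a s ^ e) := by
        simp_rw [wnorm, ← ENNReal.tsum_mul_left]
        rw [ENNReal.tsum_comm]
        exact tsum_congr fun γ => tsum_congr fun β => by ring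
    _ ≤ _ := by
        refine ENNReal.tsum_le_tsum fun γ => ?_
        gcongr
        refine (wnorm_prod_le hw hw0 _ _).trans ?_
        exact Finset.prod_le_prod' fun s _ => wnorm_pow_le hw hw0 _ _

/-- The weight `ρ^|γ|`, whose norm is the sum of the absolute values of the terms on the torus of
radius `ρ`. -/
def radiusWeight (ρ : ℝ≥0) (γ : σ →₀ ℕ) : ℝ≥0 := ρ ^ γ.degree

lemma wnorm_radiusWeight_mono {ρ ρ' : ℝ≥0} (h : ρ ≤ ρ') (f : MvPowerSeries σ ℂ) :
    wnorm (radiusWeight ρ) f ≤ wnorm (radiusWeight ρ') f :=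
  wnorm_mono (fun _ => pow_le_pow_left₀ zero_le h _) f

/-- Substitution of series of size `R ε^{v_s}` in a series whose terms all have weight at least `m`
for the weights `v_s` gains a factor `ε^m`. -/
lemma wnorm_subst_le_of_weight (hw : ∀ γ δ, w (γ + δ) ≤ w γ * w δ) (hw0 : w 0 ≤ 1)
    {a : τ → MvPowerSeries σ ℂ} (ha : HasSubst a) (f : MvPowerSeries τ ℂ)
    {R ε : ℝ≥0} (hε : ε ≤ 1) (v : τ → ℕ) (m : ℕ)
    (hv : ∀ s, wnorm w (a s) ≤ R * (ε : ℝ≥0∞) ^ v s)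
    (hf : ∀ γ : τ →₀ ℕ, coeff γ f ≠ 0 → m ≤ Finsupp.weight v γ) :
    wnorm w (subst a f) ≤ (ε : ℝ≥0∞) ^ m * wnorm (radiusWeight R) f := by
  refine (wnorm_subst_le hw hw0 ha f).trans ?_
  rw [wnorm, ← ENNReal.tsum_mul_left]
  refine ENNReal.tsum_le_tsum fun γ => ?_
  by_cases h0 : coeff γ f = 0
  · simp [h0]
  have hm := hf γ h0
  have h2 : (γ.prod fun s e => wnorm w (a s) ^ e) ≤
      (ε : ℝ≥0∞) ^ m * (radiusWeight R γ : ℝ≥0∞) := by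
    calc (γ.prod fun s e => wnorm w (a s) ^ e)
        ≤ γ.prod fun s e => ((R : ℝ≥0∞) * (ε : ℝ≥0∞) ^ v s) ^ e :=
          Finset.prod_le_prod' fun s _ => pow_le_pow_left₀ zero_le (hv s) _
      _ = (ε : ℝ≥0∞) ^ (Finsupp.weight v γ) * (radiusWeight R γ : ℝ≥0∞) := by
          rw [radiusWeight, ENNReal.coe_pow, Finsupp.weight_apply, Finsupp.degree_apply,
            Finsupp.prod, Finsupp.sum, ← Finset.prod_pow_eq_pow_sum, ← Finset.prod_pow_eq_pow_sum,
            ← Finset.prod_mul_distrib]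
          refine Finset.prod_congr rfl fun s _ => ?_
          rw [mul_pow, ← pow_mul, smul_eq_mul, mul_comm (v s), mul_comm]
      _ ≤ _ := by
          gcongr ?_ * _
          exact pow_le_pow_of_le_one zero_le (by exact_mod_cast hε) hm
  calc ‖coeff γ f‖ₑ * (γ.prod fun s e => wnorm w (a s) ^ e)
      ≤ ‖coeff γ f‖ₑ * ((ε : ℝ≥0∞) ^ m * (radiusWeight R γ : ℝ≥0∞)) := by gcongr
    _ = _ := by ring

/-- Lower semicontinuity of the norm under coefficientwise stabilization. -/
lemma wnorm_le_of_eventually_eq {f : MvPowerSeries σ ℂ} {g : ℕ → MvPowerSeries σ ℂ} {C : ℝ≥0∞}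
    (hg : ∀ n, wnorm w (g n) ≤ C)
    (h : ∀ γ, ∀ᶠ n in Filter.atTop, coeff γ (g n) = coeff γ f) : wnorm w f ≤ C := by
  rw [wnorm, ENNReal.tsum_eq_iSup_sum]
  refine iSup_le fun s => ?_
  obtain ⟨n, hn⟩ := ((Filter.eventually_all_finset s).2 fun γ _ => h γ).exists
  calc ∑ γ ∈ s, (w γ : ℝ≥0∞) * ‖coeff γ f‖ₑ
      = ∑ γ ∈ s, (w γ : ℝ≥0∞) * ‖coeff γ (g n)‖ₑ :=
        Finset.sum_congr rfl fun γ hγ => by rw [hn γ hγ]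
    _ ≤ _ := (ENNReal.sum_le_tsum s).trans (hg n)

end wnorm

/-! ### The order filtration and formal substitution -/

/-- The ideal of power series all of whose terms have weight at least `k`, for the weights `w_s` of
the variables. -/
def orderIdeal {σ : Type*} (w : σ → ℕ) (k : ℕ) : Ideal (MvPowerSeries σ ℂ) where
  carrier := {f | (k : ℕ∞) ≤ f.weightedOrder w}
  zero_mem' := by simp
  add_mem' hf hg := (le_min hf hg).trans (min_weightedOrder_le_add w)
  smul_mem' c f hf := (le_add_of_nonneg_of_le zero_le hf).trans (le_weightedOrder_mul w)

section orderIdeal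

variable {σ τ : Type*} {w : σ → ℕ}

lemma mem_orderIdeal {k : ℕ} {f : MvPowerSeries σ ℂ} :
    f ∈ orderIdeal w k ↔ ∀ d, Finsupp.weight w d < k → coeff d f = 0 :=
  ⟨fun h _ hd => coeff_eq_zero_of_lt_weightedOrder w ((Nat.cast_lt.2 hd).trans_le h),
    fun h => nat_le_weightedOrder w h⟩

lemma orderIdeal_anti {k l : ℕ} (h : k ≤ l) : orderIdeal w l ≤ orderIdeal w k :=
  fun _ hf => mem_orderIdeal.2 fun d hd => mem_orderIdeal.1 hf d (hd.trans_le h)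

lemma mul_mem_orderIdeal {k l : ℕ} {f g : MvPowerSeries σ ℂ} (hf : f ∈ orderIdeal w k)
    (hg : g ∈ orderIdeal w l) : f * g ∈ orderIdeal w (k + l) := by
  change ((k + l : ℕ) : ℕ∞) ≤ _
  rw [Nat.cast_add]
  exact (add_le_add hf hg).trans (le_weightedOrder_mul w)

lemma pow_mem_orderIdeal {f : MvPowerSeries σ ℂ} (hf : f ∈ orderIdeal w 1) (n : ℕ) :
    f ^ n ∈ orderIdeal w n := by
  induction n with
  | zero => simp [mem_orderIdeal]
  | succ n ih => rw [pow_succ]; exact mul_mem_orderIdeal ih hf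

lemma smul_mem_orderIdeal {k : ℕ} (c : ℂ) {f : MvPowerSeries σ ℂ} (hf : f ∈ orderIdeal w k) :
    c • f ∈ orderIdeal w k := by
  rw [smul_eq_C_mul]
  exact Ideal.mul_mem_left _ _ hf

lemma eq_zero_of_forall_mem_orderIdeal {f : MvPowerSeries σ ℂ}
    (h : ∀ k, f ∈ orderIdeal w k) : f = 0 := by
  ext d
  exact mem_orderIdeal.1 (h (Finsupp.weight w d + 1)) d (Nat.lt_succ_self _)

lemma constantCoeff_eq_zero_of_mem_orderIdeal {f : MvPowerSeries σ ℂ}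
    (h : f ∈ orderIdeal w 1) : constantCoeff f = 0 := by
  rw [← coeff_zero_eq_constantCoeff_apply]
  exact mem_orderIdeal.1 h 0 (by simp)

lemma mem_orderIdeal_one (hw : ∀ s, 0 < w s) {f : MvPowerSeries σ ℂ}
    (h : constantCoeff f = 0) : f ∈ orderIdeal w 1 := by
  refine mem_orderIdeal.2 fun d hd => ?_
  obtain rfl : d = 0 := by
    by_contra h0
    obtain ⟨s, hs⟩ := Finsupp.ne_iff.1 h0
    have := Finsupp.le_weight w (hw s).ne' d
    rw [Finsupp.coe_zero, Pi.zero_apply] at hs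
    omega
  rwa [coeff_zero_eq_constantCoeff_apply]

lemma X_mem_orderIdeal (s : σ) : (X s : MvPowerSeries σ ℂ) ∈ orderIdeal w (w s) := by
  classical
  refine mem_orderIdeal.2 fun d hd => ?_
  rw [coeff_X, if_neg]
  rintro rfl
  simp [Finsupp.weight_single] at hd

lemma pderiv_mem_orderIdeal (s : σ) {k : ℕ} {f : MvPowerSeries σ ℂ}
    (h : f ∈ orderIdeal w k) : pderiv ℂ s f ∈ orderIdeal w (k - w s) := by
  refine mem_orderIdeal.2 fun d hd => ?_
  rw [coeff_pderiv, mem_orderIdeal.1 h, zero_mul]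
  rw [map_add, Finsupp.weight_single, one_smul]
  omega

lemma subst_sub_subst_mem_orderIdeal {a a' : τ → MvPowerSeries σ ℂ} (ha : HasSubst a)
    (ha' : HasSubst a') {k : ℕ} (f : MvPowerSeries τ ℂ)
    (h : ∀ γ : τ →₀ ℕ, coeff γ f ≠ 0 →
      (γ.prod fun s e => a s ^ e) - (γ.prod fun s e => a' s ^ e) ∈ orderIdeal w k) :
    subst a f - subst a' f ∈ orderIdeal w k := by
  refine mem_orderIdeal.2 fun d hd => ?_
  rw [map_sub, coeff_subst ha, coeff_subst ha', sub_eq_zero]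
  refine finsum_congr fun γ => ?_
  by_cases h0 : coeff γ f = 0
  · simp [h0]
  · have := mem_orderIdeal.1 (h γ h0) d hd
    rw [map_sub, sub_eq_zero] at this
    rw [this]

lemma finsuppProd_mem_orderIdeal {a : τ → MvPowerSeries σ ℂ} (ha : ∀ s, a s ∈ orderIdeal w 1)
    (γ : τ →₀ ℕ) :
    (γ.prod fun s e => a s ^ e) ∈ orderIdeal w (Finsupp.weight (fun _ => 1) γ) := by
  classical
  induction γ using Finsupp.induction_linear with
  | zero => simp [mem_orderIdeal]
  | add γ δ ih1 ih2 =>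
    rw [Finsupp.prod_add_index' (fun _ => pow_zero _) (fun _ _ _ => pow_add _ _ _), map_add]
    exact mul_mem_orderIdeal ih1 ih2
  | single s n =>
    rw [Finsupp.prod_single_index (h := fun s e => a s ^ e) (pow_zero _), Finsupp.weight_single]
    simpa using pow_mem_orderIdeal (ha s) n

lemma subst_mem_orderIdeal {a : τ → MvPowerSeries σ ℂ} (ha : HasSubst a)
    (ha1 : ∀ s, a s ∈ orderIdeal w 1) {k : ℕ} {f : MvPowerSeries τ ℂ}
    (hf : f ∈ orderIdeal (fun _ => 1) k) : subst a f ∈ orderIdeal w k := by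
  refine mem_orderIdeal.2 fun d hd => ?_
  rw [coeff_subst ha]
  refine finsum_eq_zero_of_forall_eq_zero fun γ => ?_
  by_cases hγ : Finsupp.weight (fun _ => 1) γ < k
  · rw [mem_orderIdeal.1 hf γ hγ, zero_smul]
  · rw [mem_orderIdeal.1 (finsuppProd_mem_orderIdeal ha1 γ) d (by omega), smul_zero]

lemma finsuppProd_sub_mem {a a' : τ → MvPowerSeries σ ℂ} {I : Ideal (MvPowerSeries σ ℂ)}
    (h : ∀ s, a s - a' s ∈ I) (γ : τ →₀ ℕ) :
    (γ.prod fun s e => a s ^ e) - (γ.prod fun s e => a' s ^ e) ∈ I := by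
  rw [← Ideal.Quotient.eq, Finsupp.prod, Finsupp.prod, map_prod, map_prod]
  refine Finset.prod_congr rfl fun s _ => ?_
  rw [map_pow, map_pow, Ideal.Quotient.eq.2 (h s)]

/-- If `G(x, y)` has no term linear in `y` and constant in `x`, then `y ↦ G(x, y)` is contracting
for the order filtration. -/
lemma subst_sub_subst_mem_of_no_linear_term {ι κ : Type*} [Finite ι] [Finite κ]
    {x : ι → MvPowerSeries σ ℂ} {y z : κ → MvPowerSeries σ ℂ}
    (hx : ∀ i, x i ∈ orderIdeal w 1) (hy : ∀ j, y j ∈ orderIdeal w 1)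
    (hz : ∀ j, z j ∈ orderIdeal w 1) {k : ℕ} (hyz : ∀ j, y j - z j ∈ orderIdeal w k)
    (G : MvPowerSeries (ι ⊕ κ) ℂ) (hG : ∀ j, coeff (Finsupp.single (Sum.inr j) 1) G = 0) :
    subst (Sum.elim x y) G - subst (Sum.elim x z) G ∈ orderIdeal w (k + 1) := by
  classical
  have hxy : ∀ s, Sum.elim x y s ∈ orderIdeal w 1 := by rintro (i | j); exacts [hx i, hy j]
  have hxz : ∀ s, Sum.elim x z s ∈ orderIdeal w 1 := by rintro (i | j); exacts [hx i, hz j]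
  have hd : ∀ s, Sum.elim x y s - Sum.elim x z s ∈ orderIdeal w k := by
    rintro (i | j)
    · simp
    · exact hyz j
  refine subst_sub_subst_mem_orderIdeal
    (hasSubst_of_constantCoeff_zero fun s => constantCoeff_eq_zero_of_mem_orderIdeal (hxy s))
    (hasSubst_of_constantCoeff_zero fun s => constantCoeff_eq_zero_of_mem_orderIdeal (hxz s)) G ?_
  intro γ hγ
  by_cases hpure : ∀ j, γ (Sum.inr j) = 0
  · -- a monomial in `x` alone contributes nothing to the difference
    have : (γ.prod fun s e => Sum.elim x y s ^ e) = γ.prod fun s e => Sum.elim x z s ^ e := by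
      refine Finset.prod_congr rfl ?_
      rintro (i | j) _
      · rfl
      · simp [hpure j]
    rw [this, sub_self]
    exact Ideal.zero_mem _
  push Not at hpure
  obtain ⟨j, hj⟩ := hpure
  obtain ⟨δ, rfl⟩ : ∃ δ, γ = Finsupp.single (Sum.inr j) 1 + δ := by
    refine ⟨γ - Finsupp.single (Sum.inr j) 1, (add_tsub_cancel_of_le ?_).symm⟩
    rw [Finsupp.single_le_iff]
    omega
  have hδ : δ ≠ 0 := by
    rintro rfl
    exact hγ (by rw [add_zero, hG])
  obtain ⟨s, hs⟩ := Finsupp.ne_iff.1 hδ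
  have hsplit : ∀ b : ι ⊕ κ → MvPowerSeries σ ℂ,
      ((Finsupp.single (Sum.inr j) 1 + δ).prod fun s e => b s ^ e) =
        b (Sum.inr j) * δ.prod fun s e => b s ^ e := by
    intro b
    rw [Finsupp.prod_add_index' (fun _ => pow_zero _) (fun _ _ _ => pow_add _ _ _),
      Finsupp.prod_single_index (h := fun s e => b s ^ e) (pow_zero _), pow_one]
  have hmem : (δ.prod fun s e => Sum.elim x y s ^ e) ∈ orderIdeal w 1 := by
    refine Ideal.mem_of_dvd _ (Finset.dvd_prod_of_mem _ (Finsupp.mem_support_iff.2 hs)) ?_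
    exact Ideal.pow_mem_of_mem _ (hxy s) _ (Nat.pos_of_ne_zero hs)
  rw [hsplit, hsplit]
  have e : Sum.elim x y (Sum.inr j) * (δ.prod fun s e => Sum.elim x y s ^ e) -
      Sum.elim x z (Sum.inr j) * (δ.prod fun s e => Sum.elim x z s ^ e) =
      (y j - z j) * (δ.prod fun s e => Sum.elim x y s ^ e) +
      ((δ.prod fun s e => Sum.elim x y s ^ e) - (δ.prod fun s e => Sum.elim x z s ^ e)) * z j := by
    simp only [Sum.elim_inr]
    ring
  rw [e]
  exact Ideal.add_mem _ (mul_mem_orderIdeal (hyz j) hmem)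
    (mul_mem_orderIdeal (finsuppProd_sub_mem hd δ) (hz j))

/-- A linear form on power series that vanishes on polynomials and on series of high order
vanishes. -/
lemma linearMap_eq_zero [Finite σ] (T : MvPowerSeries σ ℂ →ₗ[ℂ] ℂ) (m : ℕ)
    (hT : ∀ f ∈ orderIdeal (fun _ => 1) m, T f = 0)
    (hp : ∀ p : MvPolynomial σ ℂ, T p = 0) (f : MvPowerSeries σ ℂ) : T f = 0 := by
  have h : f - (truncTotal m f : MvPowerSeries σ ℂ) ∈ orderIdeal (fun _ => 1) m := by
    refine mem_orderIdeal.2 fun d hd => ?_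
    have hd' : d.degree < m := by
      rw [Finsupp.degree_eq_weight_one]
      exact hd
    rw [map_sub, MvPolynomial.coeff_coe, coeff_truncTotal _ hd', sub_self]
  have := hT _ h
  rwa [map_sub, hp, sub_zero] at this

/-- The chain rule for substitution of power series without constant term. -/
lemma pderiv_subst [Fintype τ] [Finite σ] {a : τ → MvPowerSeries σ ℂ}
    (ha : ∀ s, constantCoeff (a s) = 0) (i : σ) (f : MvPowerSeries τ ℂ) :
    pderiv ℂ i (subst a f) = ∑ s, subst a (pderiv ℂ s f) * pderiv ℂ i (a s) := by
  classical
  have hs : HasSubst a := hasSubst_of_constantCoeff_zero ha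
  have ha1 : ∀ s, a s ∈ orderIdeal (fun _ => 1) 1 := fun s =>
    mem_orderIdeal_one (fun _ => one_pos) (ha s)
  let D : MvPowerSeries τ ℂ →ₗ[ℂ] MvPowerSeries σ ℂ :=
    (pderiv ℂ i).toLinearMap ∘ₗ (substAlgHom hs).toLinearMap -
      ∑ s, LinearMap.mulRight ℂ (pderiv ℂ i (a s)) ∘ₗ (substAlgHom hs).toLinearMap ∘ₗ
        (pderiv ℂ s).toLinearMap
  have hD : ∀ g, D g = pderiv ℂ i (subst a g) - ∑ s, subst a (pderiv ℂ s g) * pderiv ℂ i (a s) := by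
    intro g
    simp [D, LinearMap.sum_apply, coe_substAlgHom]
  suffices h : D f = 0 by
    rw [hD, sub_eq_zero] at h
    exact h
  ext d
  refine linearMap_eq_zero (coeff d ∘ₗ D) (Finsupp.weight (fun _ => 1) d + 2) ?_ ?_ f
  · intro g hg
    rw [LinearMap.comp_apply, hD]
    have hmem : pderiv ℂ i (subst a g) - ∑ s, subst a (pderiv ℂ s g) * pderiv ℂ i (a s) ∈
        orderIdeal (fun _ => 1) (Finsupp.weight (fun _ => 1) d + 1) :=
      Ideal.sub_mem _ (pderiv_mem_orderIdeal i (subst_mem_orderIdeal hs ha1 hg))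
        (Ideal.sum_mem _ fun s _ => Ideal.mul_mem_right _ _
          (subst_mem_orderIdeal hs ha1 (pderiv_mem_orderIdeal s hg)))
    exact mem_orderIdeal.1 hmem d (Nat.lt_succ_self _)
  · intro p
    suffices h : D p = 0 by rw [LinearMap.comp_apply, h, map_zero]
    rw [hD, sub_eq_zero]
    induction p using MvPolynomial.induction_on with
    | C c =>
      simp only [MvPolynomial.coe_C, pderiv_C, ← coe_substAlgHom hs, map_zero, zero_mul,
        Finset.sum_const_zero]
      rw [show (C c : MvPowerSeries τ ℂ) = algebraMap ℂ _ c from rfl, AlgHom.commutes]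
      simp
    | add p q hp hq =>
      simp only [MvPolynomial.coe_add, map_add, subst_add hs, hp, hq, add_mul,
        Finset.sum_add_distrib]
    | mul_X p n hp =>
      simp only [MvPolynomial.coe_mul, MvPolynomial.coe_X, subst_mul hs, subst_X hs,
        Derivation.leibniz, subst_add hs, smul_eq_mul, hp, add_mul, Finset.sum_add_distrib,
        Finset.mul_sum]
      congr 1
      · rw [Finset.sum_eq_single n]
        · rw [pderiv_X_self, ← coe_substAlgHom hs, map_one, mul_one]
        · intro s _ hsn
          rw [pderiv_X_of_ne hsn.symm, ← coe_substAlgHom hs, map_zero, mul_zero, zero_mul]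
        · simp
      · exact Finset.sum_congr rfl fun s _ => by ring

end orderIdeal

/-! ### Fixed points of contractions for the order filtration -/

section fixedPoint

variable {σ κ : Type*} {w : σ → ℕ}

/-- A map that is contracting for the order filtration and preserves a ball for a weighted norm has
a fixed point in that ball: the iterates stabilize coefficientwise, and the bound passes to the
limit. No completeness or Lipschitz estimate for the norm is needed. -/
lemma exists_fixedPoint_of_contracting (Φ : (κ → MvPowerSeries σ ℂ) → κ → MvPowerSeries σ ℂ)
    (h1 : ∀ Y, (∀ i, Y i ∈ orderIdeal w 1) → ∀ i, Φ Y i ∈ orderIdeal w 1)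
    (hc : ∀ Y Z k, (∀ i, Y i ∈ orderIdeal w 1) → (∀ i, Z i ∈ orderIdeal w 1) →
      (∀ i, Y i - Z i ∈ orderIdeal w k) → ∀ i, Φ Y i - Φ Z i ∈ orderIdeal w (k + 1))
    (W : (σ →₀ ℕ) → ℝ≥0) (C : ℝ≥0∞)
    (hn : ∀ Y, (∀ i, Y i ∈ orderIdeal w 1) → (∀ i, wnorm W (Y i) ≤ C) →
      ∀ i, wnorm W (Φ Y i) ≤ C) :
    ∃ Y, (∀ i, Y i ∈ orderIdeal w 1) ∧ Φ Y = Y ∧ ∀ i, wnorm W (Y i) ≤ C := by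
  let y : ℕ → κ → MvPowerSeries σ ℂ := fun m => Φ^[m] 0
  have hs : ∀ m, y (m + 1) = Φ (y m) := fun m => Function.iterate_succ_apply' Φ m 0
  have hy1 : ∀ m i, y m i ∈ orderIdeal w 1 := by
    intro m
    induction m with
    | zero => intro i; exact Ideal.zero_mem _
    | succ m ih => rw [hs]; exact h1 _ ih
  have hyn : ∀ m i, wnorm W (y m i) ≤ C := by
    intro m
    induction m with
    | zero => intro i; exact wnorm_zero.trans_le zero_le
    | succ m ih => rw [hs]; exact hn _ (hy1 m) ih
  have hstep : ∀ m i, y (m + 1) i - y m i ∈ orderIdeal w m := by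
    intro m
    induction m with
    | zero => intro i; exact mem_orderIdeal.2 fun d hd => absurd hd (Nat.not_lt_zero _)
    | succ m ih => rw [hs (m + 1), hs m]; rw [hs m] at ih; exact hc _ _ m (h1 _ (hy1 m)) (hy1 m) ih
  have hcauchy : ∀ m n i, m ≤ n → y n i - y m i ∈ orderIdeal w m := by
    intro m n i hmn
    induction n, hmn using Nat.le_induction with
    | base => rw [sub_self]; exact Ideal.zero_mem _
    | succ n hmn ih =>
      rw [← sub_add_sub_cancel _ (y n i)]
      exact Ideal.add_mem _ (orderIdeal_anti hmn (hstep n i)) ih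
  let Y : κ → MvPowerSeries σ ℂ := fun i d => coeff d (y (Finsupp.weight w d + 1) i)
  have hYc : ∀ i d, coeff d (Y i) = coeff d (y (Finsupp.weight w d + 1) i) := fun i d => rfl
  have hY : ∀ m i, Y i - y m i ∈ orderIdeal w m := by
    intro m i
    refine mem_orderIdeal.2 fun d hd => ?_
    have := mem_orderIdeal.1 (hcauchy (Finsupp.weight w d + 1) m i hd) d (Nat.lt_succ_self _)
    rw [map_sub, sub_eq_zero] at this
    rw [map_sub, sub_eq_zero, hYc, this]
  have hY1 : ∀ i, Y i ∈ orderIdeal w 1 := fun i => by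
    rw [← sub_add_cancel (Y i) (y 1 i)]
    exact Ideal.add_mem _ (hY 1 i) (hy1 1 i)
  refine ⟨Y, hY1, ?_, fun i => ?_⟩
  · funext i
    rw [← sub_eq_zero]
    refine eq_zero_of_forall_mem_orderIdeal (w := w) fun m => ?_
    have e : Φ Y i - Y i = (Φ Y i - Φ (y m) i) - (Y i - y (m + 1) i) := by
      rw [hs]
      ring
    rw [e]
    exact orderIdeal_anti m.le_succ (Ideal.sub_mem _ (hc _ _ m hY1 (hy1 m) (hY m) i) (hY (m + 1) i))
  · refine wnorm_le_of_eventually_eq (g := fun m => y m i) (fun m => hyn m i) fun d => ?_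
    filter_upwards [Filter.eventually_gt_atTop (Finsupp.weight w d)] with m hm
    have := mem_orderIdeal.1 (hY m i) d hm
    rw [map_sub, sub_eq_zero] at this
    exact this.symm

end fixedPoint

/-! ### The Gevrey weight in the variables `(x, t)` -/

section gevreyWeight

variable {ι κ : Type*} [Fintype ι]

/-- The degree in `x` of an exponent in the variables `(x, t)`. -/
def xDegree (γ : ι ⊕ Unit →₀ ℕ) : ℕ := ∑ i, γ (Sum.inl i)

/-- The weight `ρ^k T^n k! / (n + k)!` of a monomial of degree `k` in `x` and degree `n` in `t`.
Finiteness of this norm means Gevrey order one in `t`. The quotient `k! / (n + k)!`, in place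
of `1 / n!`, makes `t ∂_{x_j}` and `t² ∂_t` bounded operators. -/
def gevreyWeight (ρ T : ℝ≥0) (γ : ι ⊕ Unit →₀ ℕ) : ℝ≥0 :=
  ρ ^ xDegree γ * T ^ γ (Sum.inr ()) *
    ((xDegree γ).factorial / (γ (Sum.inr ()) + xDegree γ).factorial)

lemma xDegree_add (γ δ : ι ⊕ Unit →₀ ℕ) : xDegree (γ + δ) = xDegree γ + xDegree δ := by
  simp [xDegree, Finset.sum_add_distrib]

lemma xDegree_single_inl (i : ι) : xDegree (Finsupp.single (Sum.inl i : ι ⊕ Unit) 1) = 1 := by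
  classical
  simp [xDegree, Finsupp.single_apply]

lemma xDegree_single_inr : xDegree (Finsupp.single (Sum.inr () : ι ⊕ Unit) 1) = 0 := by
  simp [xDegree]

lemma factorial_add_mul_le (n k n' k' : ℕ) :
    (k + k').factorial * ((n + k).factorial * (n' + k').factorial) ≤
      k.factorial * k'.factorial * (n + n' + (k + k')).factorial := by
  have hch : (k + k').choose k' ≤ (n + k + (n' + k')).choose (n' + k') :=
    calc (k + k').choose k' = (k + k').choose k := (Nat.choose_symm_add).symm
      _ ≤ (k + (n' + k')).choose k := Nat.choose_le_choose _ (by omega)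
      _ = (k + (n' + k')).choose (n' + k') := Nat.choose_symm_add
      _ ≤ _ := Nat.choose_le_choose _ (by omega)
  have e1 := Nat.add_choose_mul_factorial_mul_factorial k k'
  have e2 := Nat.add_choose_mul_factorial_mul_factorial (n + k) (n' + k')
  rw [show n + n' + (k + k') = n + k + (n' + k') by ring, ← e1, ← e2]
  calc _ = (k + k').choose k' *
        (k.factorial * k'.factorial * ((n + k).factorial * (n' + k').factorial)) := by ring
    _ ≤ (n + k + (n' + k')).choose (n' + k') *
        (k.factorial * k'.factorial * ((n + k).factorial * (n' + k').factorial)) := by gcongr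
    _ = _ := by ring

lemma gevreyWeight_add_le (ρ T : ℝ≥0) (γ δ : ι ⊕ Unit →₀ ℕ) :
    gevreyWeight ρ T (γ + δ) ≤ gevreyWeight ρ T γ * gevreyWeight ρ T δ := by
  set k := xDegree γ
  set k' := xDegree δ
  set n := γ (Sum.inr ())
  set n' := δ (Sum.inr ())
  have h : ((k + k').factorial / (n + n' + (k + k')).factorial : ℝ≥0) ≤
      (k.factorial / (n + k).factorial) * (k'.factorial / (n' + k').factorial) := by
    rw [div_mul_div_comm, div_le_div_iff₀ (by positivity) (by positivity)]
    exact_mod_cast factorial_add_mul_le n k n' k'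
  calc gevreyWeight ρ T (γ + δ) = ρ ^ (k + k') * T ^ (n + n') *
        ((k + k').factorial / (n + n' + (k + k')).factorial) := by
        rw [gevreyWeight, xDegree_add]
        rfl
    _ ≤ ρ ^ (k + k') * T ^ (n + n') *
        ((k.factorial / (n + k).factorial) * (k'.factorial / (n' + k').factorial)) := by gcongr
    _ = (ρ ^ k * T ^ n * (k.factorial / (n + k).factorial)) *
        (ρ ^ k' * T ^ n' * (k'.factorial / (n' + k').factorial)) := by ring

lemma gevreyWeight_zero (ρ T : ℝ≥0) : gevreyWeight ρ T (0 : ι ⊕ Unit →₀ ℕ) ≤ 1 := by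
  simp [gevreyWeight, xDegree]

/-- `t ∂_{x_j}` is bounded, of norm at most `T / ρ`. -/
lemma wnorm_X_mul_pderiv_inl_le {ρ : ℝ≥0} (hρ : ρ ≠ 0) (T : ℝ≥0) (j : ι)
    (f : MvPowerSeries (ι ⊕ Unit) ℂ) :
    wnorm (gevreyWeight ρ T) (X (Sum.inr ()) * pderiv ℂ (Sum.inl j) f) ≤
      (T / ρ : ℝ≥0) * wnorm (gevreyWeight ρ T) f := by
  refine (wnorm_X_mul_le (c := 1)
    (w' := fun γ => gevreyWeight ρ T (γ + Finsupp.single (Sum.inr ()) 1)) (by simp) _).trans ?_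
  rw [ENNReal.coe_one, one_mul]
  refine wnorm_pderiv_le (fun γ => ?_) f
  set k := xDegree γ with hk
  set n := γ (Sum.inr ()) with hn
  have hle : (γ (Sum.inl j) + 1 : ℝ≥0) ≤ k + 1 := by
    have : γ (Sum.inl j) ≤ k := Finset.single_le_sum (f := fun i => γ (Sum.inl i))
      (fun _ _ => zero_le) (Finset.mem_univ j)
    gcongr
  have e1 : gevreyWeight ρ T (γ + Finsupp.single (Sum.inr ()) 1) =
      ρ ^ k * T ^ (n + 1) * (k.factorial / (n + 1 + k).factorial) := by
    simp [gevreyWeight, xDegree_add, xDegree_single_inr, hk, hn]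
  have e2 : gevreyWeight ρ T (γ + Finsupp.single (Sum.inl j) 1) =
      ρ ^ (k + 1) * T ^ n * ((k + 1).factorial / (n + (k + 1)).factorial) := by
    simp [gevreyWeight, xDegree_add, xDegree_single_inl, hk, hn]
  rw [e1, e2, show n + (k + 1) = n + 1 + k by ring, Nat.factorial_succ k]
  calc ρ ^ k * T ^ (n + 1) * (k.factorial / (n + 1 + k).factorial) * (γ (Sum.inl j) + 1)
      ≤ ρ ^ k * T ^ (n + 1) * (k.factorial / (n + 1 + k).factorial) * (k + 1) := by gcongr
    _ = _ := by
      push_cast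
      field_simp
      ring

/-- `t² ∂_t` is bounded, of norm at most `T`. -/
lemma wnorm_X_mul_X_mul_pderiv_inr_le (ρ T : ℝ≥0) (f : MvPowerSeries (ι ⊕ Unit) ℂ) :
    wnorm (gevreyWeight ρ T) (X (Sum.inr ()) * (X (Sum.inr ()) * pderiv ℂ (Sum.inr ()) f)) ≤
      T * wnorm (gevreyWeight ρ T) f := by
  refine (wnorm_X_mul_le (c := 1)
    (w' := fun γ => gevreyWeight ρ T (γ + Finsupp.single (Sum.inr ()) 1)) (by simp) _).trans ?_
  rw [ENNReal.coe_one, one_mul]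
  refine (wnorm_X_mul_le (c := 1) (w' := fun γ => gevreyWeight ρ T
    (γ + Finsupp.single (Sum.inr ()) 1 + Finsupp.single (Sum.inr ()) 1)) (by simp) _).trans ?_
  rw [ENNReal.coe_one, one_mul]
  refine wnorm_pderiv_le (fun γ => ?_) f
  set k := xDegree γ with hk
  set n := γ (Sum.inr ()) with hn
  have e1 : gevreyWeight ρ T (γ + Finsupp.single (Sum.inr ()) 1 + Finsupp.single (Sum.inr ()) 1) =
      ρ ^ k * T ^ (n + 1 + 1) * (k.factorial / (n + 1 + 1 + k).factorial) := by
    simp [gevreyWeight, xDegree_add, xDegree_single_inr, hk, hn]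
  have e2 : gevreyWeight ρ T (γ + Finsupp.single (Sum.inr ()) 1) =
      ρ ^ k * T ^ (n + 1) * (k.factorial / (n + 1 + k).factorial) := by
    simp [gevreyWeight, xDegree_add, xDegree_single_inr, hk, hn]
  rw [e1, e2, show n + 1 + 1 + k = (n + 1 + k) + 1 by ring, Nat.factorial_succ]
  calc ρ ^ k * T ^ (n + 1 + 1) *
        (k.factorial / (((n + 1 + k + 1) * (n + 1 + k).factorial : ℕ) : ℝ≥0)) * (n + 1)
      = T * (ρ ^ k * T ^ (n + 1) * (k.factorial / (n + 1 + k).factorial)) *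
          ((n + 1) / (n + 1 + k + 1)) := by
        push_cast
        field_simp
        ring
    _ ≤ T * (ρ ^ k * T ^ (n + 1) * (k.factorial / (n + 1 + k).factorial)) * 1 := by
        gcongr
        refine div_le_one_of_le₀ ?_ zero_le
        rw [add_assoc _ (k : ℝ≥0)]
        exact le_self_add
    _ = _ := mul_one _

end gevreyWeight

/-! ### The lifted equation in the variables `(x, t)` -/

section lift

variable {ι κ : Type*} [Fintype ι]

/-- The derivation `∑_j a_j ∂_{x_j}` of the ring of formal power series. -/
def formalDerivation (a : ι → MvPowerSeries ι ℂ) :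
    Derivation ℂ (MvPowerSeries ι ℂ) (MvPowerSeries ι ℂ) :=
  ∑ j, a j • pderiv ℂ j

lemma formalDerivation_apply (a : ι → MvPowerSeries ι ℂ) (f : MvPowerSeries ι ℂ) :
    formalDerivation a f = ∑ j, a j * pderiv ℂ j f := by
  have : ⇑(∑ j, a j • pderiv ℂ j) = ∑ j, ⇑(a j • pderiv ℂ j) :=
    map_sum (Derivation.coeFnAddMonoidHom (R := ℂ) (A := MvPowerSeries ι ℂ)) _ _
  rw [formalDerivation, this, Finset.sum_apply]
  rfl

/-- A power series in `x` viewed as a power series in `(x, t)`. -/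
def liftX (f : MvPowerSeries ι ℂ) : MvPowerSeries (ι ⊕ Unit) ℂ :=
  subst (fun i => X (Sum.inl i)) f

lemma hasSubst_X_inl : HasSubst (fun i : ι => (X (Sum.inl i) : MvPowerSeries (ι ⊕ Unit) ℂ)) :=
  hasSubst_of_constantCoeff_zero fun i => constantCoeff_X (Sum.inl i)

/-- The operator `t (∑_j a_j ∂_{x_j} + h t ∂_t)`. It becomes `P L` under the substitution of `P` for
`t` when `L(P) = h P`. -/
def liftedField (a : ι → MvPowerSeries ι ℂ) (h : MvPowerSeries ι ℂ)
    (f : MvPowerSeries (ι ⊕ Unit) ℂ) : MvPowerSeries (ι ⊕ Unit) ℂ :=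
  ∑ j, liftX (a j) * (X (Sum.inr ()) * pderiv ℂ (Sum.inl j) f) +
    liftX h * (X (Sum.inr ()) * (X (Sum.inr ()) * pderiv ℂ (Sum.inr ()) f))

/-- The substitution of `P` for `t`. -/
def substTime (P : MvPowerSeries ι ℂ) (f : MvPowerSeries (ι ⊕ Unit) ℂ) : MvPowerSeries ι ℂ :=
  subst (Sum.elim X fun _ => P) f

lemma constantCoeff_elim_X_eq_zero {ι : Type*} {P : MvPowerSeries ι ℂ} (hP : constantCoeff P = 0)
    (s : ι ⊕ Unit) :
    constantCoeff (Sum.elim X (fun _ => P) s : MvPowerSeries ι ℂ) = 0 := by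
  rcases s with i | _
  · exact constantCoeff_X i
  · exact hP

lemma hasSubst_elim_X {P : MvPowerSeries ι ℂ} (hP : constantCoeff P = 0) :
    HasSubst (Sum.elim X (fun _ => P) : ι ⊕ Unit → MvPowerSeries ι ℂ) :=
  hasSubst_of_constantCoeff_zero (constantCoeff_elim_X_eq_zero hP)

lemma substTime_liftX {P : MvPowerSeries ι ℂ} (hP : constantCoeff P = 0)
    (f : MvPowerSeries ι ℂ) : substTime P (liftX f) = f := by
  rw [substTime, liftX, subst_comp_subst_apply hasSubst_X_inl (hasSubst_elim_X hP)]
  simp only [subst_X (hasSubst_elim_X hP), Sum.elim_inl]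
  exact congrFun subst_self f

/-- The substitution `t = P` carries the lifted operator to `P L`: this is where the divisibility of
`L(P)` by `P` enters. -/
lemma substTime_liftedField {P h : MvPowerSeries ι ℂ} (hP : constantCoeff P = 0)
    (a : ι → MvPowerSeries ι ℂ) (hdvd : formalDerivation a P = P * h)
    (f : MvPowerSeries (ι ⊕ Unit) ℂ) :
    substTime P (liftedField a h f) = P * formalDerivation a (substTime P f) := by
  classical
  have hs := hasSubst_elim_X hP
  have hX : ∀ s, substTime P (X s) = Sum.elim X (fun _ => P) s := fun s => subst_X hs s
  have hmul : ∀ f g, substTime P (f * g) = substTime P f * substTime P g := fun f g =>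
    subst_mul hs f g
  have hadd : ∀ f g, substTime P (f + g) = substTime P f + substTime P g := fun f g =>
    subst_add hs f g
  have hsum : ∀ g : ι → MvPowerSeries (ι ⊕ Unit) ℂ,
      substTime P (∑ j, g j) = ∑ j, substTime P (g j) := fun g => by
    simp only [substTime, ← coe_substAlgHom hs, map_sum]
  have hd : ∀ j, pderiv ℂ j (substTime P f) = substTime P (pderiv ℂ (Sum.inl j) f) +
      substTime P (pderiv ℂ (Sum.inr ()) f) * pderiv ℂ j P := by
    intro j
    rw [substTime, pderiv_subst (constantCoeff_elim_X_eq_zero hP), Fintype.sum_sum_type,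
      Finset.sum_eq_single j]
    · simp [substTime]
    · intro i _ hij
      rw [Sum.elim_inl, pderiv_X_of_ne hij, mul_zero]
    · simp
  rw [formalDerivation_apply] at hdvd ⊢
  simp only [liftedField, hadd, hsum, hmul, hX, Sum.elim_inr, substTime_liftX hP, hd, mul_add,
    Finset.sum_add_distrib, Finset.mul_sum]
  congr 1
  · exact Finset.sum_congr rfl fun j _ => by ring
  · calc h * (P * (P * substTime P (pderiv ℂ (Sum.inr ()) f)))
        = P * (P * h) * substTime P (pderiv ℂ (Sum.inr ()) f) := by ring
      _ = _ := by
        rw [← hdvd, Finset.mul_sum, Finset.sum_mul]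
        exact Finset.sum_congr rfl fun j _ => by ring

lemma wnorm_liftX_le (ρ T : ℝ≥0) (f : MvPowerSeries ι ℂ) :
    wnorm (gevreyWeight ρ T) (liftX f) ≤ wnorm (radiusWeight ρ) f := by
  have := wnorm_subst_le_of_weight (w := gevreyWeight ρ T) (gevreyWeight_add_le ρ T)
    (gevreyWeight_zero ρ T) hasSubst_X_inl f (R := ρ) (ε := 1) le_rfl (fun _ => 0) 0
    (fun i => by simp [wnorm_X, gevreyWeight, xDegree_single_inl]) (fun _ _ => zero_le)
  simpa [liftX] using this

lemma wnorm_liftedField_le {ρ : ℝ≥0} (hρ : ρ ≠ 0) (T : ℝ≥0) (a : ι → MvPowerSeries ι ℂ)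
    (h : MvPowerSeries ι ℂ) (f : MvPowerSeries (ι ⊕ Unit) ℂ) :
    wnorm (gevreyWeight ρ T) (liftedField a h f) ≤
      (∑ j, wnorm (radiusWeight ρ) (a j) + wnorm (radiusWeight ρ) h) *
        ((T / ρ + T : ℝ≥0) * wnorm (gevreyWeight ρ T) f) := by
  have hw := gevreyWeight_add_le (ι := ι) ρ T
  rw [add_mul, Finset.sum_mul]
  refine (wnorm_add_le _ _).trans (add_le_add ((wnorm_sum_le _ _).trans
    (Finset.sum_le_sum fun j _ => ?_)) ?_)
  · refine (wnorm_mul_le hw _ _).trans (mul_le_mul' (wnorm_liftX_le ρ T _) ?_)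
    refine (wnorm_X_mul_pderiv_inl_le hρ T j f).trans ?_
    gcongr
    exact le_self_add
  · refine (wnorm_mul_le hw _ _).trans (mul_le_mul' (wnorm_liftX_le ρ T _) ?_)
    refine (wnorm_X_mul_X_mul_pderiv_inr_le ρ T f).trans ?_
    gcongr
    exact le_add_self

lemma liftedField_sub (a : ι → MvPowerSeries ι ℂ) (h : MvPowerSeries ι ℂ)
    (f g : MvPowerSeries (ι ⊕ Unit) ℂ) :
    liftedField a h (f - g) = liftedField a h f - liftedField a h g := by
  simp only [liftedField, map_sub, mul_sub, Finset.sum_sub_distrib]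
  ring

/-- With weight `1` for the `x_j` and weight `2` for `t`, the lifted operator raises the order. -/
lemma liftedField_mem_orderIdeal (a : ι → MvPowerSeries ι ℂ) (h : MvPowerSeries ι ℂ) {k : ℕ}
    {f : MvPowerSeries (ι ⊕ Unit) ℂ}
    (hf : f ∈ orderIdeal (Sum.elim (fun _ => 1) fun _ => 2) k) :
    liftedField a h f ∈ orderIdeal (Sum.elim (fun _ => 1) fun _ => 2) (k + 1) := by
  have ht : (X (Sum.inr ()) : MvPowerSeries (ι ⊕ Unit) ℂ) ∈
      orderIdeal (Sum.elim (fun _ => 1) fun _ => 2) 2 := X_mem_orderIdeal (Sum.inr ())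
  refine Ideal.add_mem _ (Ideal.sum_mem _ fun j _ => Ideal.mul_mem_left _ _ ?_)
    (Ideal.mul_mem_left _ _ ?_)
  · refine orderIdeal_anti ?_ (mul_mem_orderIdeal ht (pderiv_mem_orderIdeal (Sum.inl j) hf))
    rw [Sum.elim_inl]
    omega
  · refine orderIdeal_anti ?_ (mul_mem_orderIdeal ht (mul_mem_orderIdeal ht
      (pderiv_mem_orderIdeal (Sum.inr ()) hf)))
    rw [Sum.elim_inr]
    omega

lemma exists_pos_mul_le (c : ℝ≥0) {d : ℝ≥0} (hd : 0 < d) :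
    ∃ ε : ℝ≥0, 0 < ε ∧ ε ≤ 1 ∧ c * ε ≤ d := by
  refine ⟨min 1 (d / (c + 1)), lt_min one_pos (by positivity), min_le_left _ _, ?_⟩
  calc c * min 1 (d / (c + 1)) ≤ (c + 1) * (d / (c + 1)) := by
        gcongr
        · exact le_self_add
        · exact min_le_right _ _
    _ = d := by field_simp

/-- The exponents of a series without constant term and without terms linear in `y` and constant in
`x` have weight at least `2` when `x_i` has weight `2` and `y_j` has weight `1`. -/
lemma two_le_weight {ι κ : Type*} {G : MvPowerSeries (ι ⊕ κ) ℂ} (hG0 : constantCoeff G = 0)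
    (hG1 : ∀ j, coeff (Finsupp.single (Sum.inr j) 1) G = 0) (γ : ι ⊕ κ →₀ ℕ)
    (hγ : coeff γ G ≠ 0) :
    2 ≤ Finsupp.weight (Sum.elim (fun _ => 2) fun _ => 1) γ := by
  set v : ι ⊕ κ → ℕ := Sum.elim (fun _ => 2) fun _ => 1
  have hv : ∀ s, v s ≠ 0 := by rintro (i | j) <;> simp [v]
  have hpos : ∀ δ : ι ⊕ κ →₀ ℕ, δ ≠ 0 → 1 ≤ Finsupp.weight v δ := by
    intro δ hδ
    obtain ⟨s, hs⟩ := Finsupp.ne_iff.1 hδ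
    exact (Nat.one_le_iff_ne_zero.2 hs).trans (Finsupp.le_weight v (hv s) δ)
  have h0 : γ ≠ 0 := by
    rintro rfl
    exact hγ (by rw [coeff_zero_eq_constantCoeff_apply, hG0])
  obtain ⟨s, hs⟩ := Finsupp.ne_iff.1 h0
  obtain ⟨δ, rfl⟩ : ∃ δ, γ = Finsupp.single s 1 + δ :=
    ⟨γ - Finsupp.single s 1, (add_tsub_cancel_of_le
      (Finsupp.single_le_iff.2 (Nat.one_le_iff_ne_zero.2 hs))).symm⟩
  rw [map_add, Finsupp.weight_single, one_smul]
  rcases s with i | j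
  · exact le_self_add
  · have : δ ≠ 0 := by
      rintro rfl
      exact hγ (by rw [add_zero, hG1])
    exact add_le_add le_rfl (hpos δ this)

/-- The lifted equation, in fixed point form, has a solution of Gevrey order one in `t`. -/
theorem exists_gevrey_fixedPoint [Fintype κ] (a : ι → MvPowerSeries ι ℂ) (h : MvPowerSeries ι ℂ)
    (G : κ → MvPowerSeries (ι ⊕ κ) ℂ) (ν : Matrix κ κ ℂ) {R : ℝ≥0} (hR : 0 < R)
    (ha : ∀ j, wnorm (radiusWeight R) (a j) ≠ ∞) (hh : wnorm (radiusWeight R) h ≠ ∞)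
    (hG : ∀ j, wnorm (radiusWeight R) (G j) ≠ ∞) (hG0 : ∀ j, constantCoeff (G j) = 0)
    (hG1 : ∀ i j, coeff (Finsupp.single (Sum.inr j) 1) (G i) = 0) :
    ∃ ρ T C : ℝ≥0, 0 < ρ ∧ 0 < T ∧ ∃ Y : κ → MvPowerSeries (ι ⊕ Unit) ℂ,
      (∀ i, constantCoeff (Y i) = 0) ∧
      (∀ i, Y i = ∑ j, ν i j • (liftedField a h (Y j) -
        subst (Sum.elim (fun l => X (Sum.inl l)) Y) (G j))) ∧
      ∀ i, wnorm (gevreyWeight ρ T) (Y i) ≤ C := by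
  classical
  obtain ⟨M, hM⟩ : ∃ M : ℝ≥0, ∑ j, wnorm (radiusWeight R) (G j) = M :=
    ⟨_, (ENNReal.coe_toNNReal (ENNReal.sum_ne_top.2 fun j _ => hG j)).symm⟩
  obtain ⟨B, hB⟩ : ∃ B : ℝ≥0, ∑ j, wnorm (radiusWeight R) (a j) + wnorm (radiusWeight R) h = B :=
    ⟨_, (ENNReal.coe_toNNReal (ENNReal.add_ne_top.2
      ⟨ENNReal.sum_ne_top.2 fun j _ => ha j, hh⟩)).symm⟩
  set K : ℝ≥0 := ∑ i, ∑ j, ‖ν i j‖₊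
  -- `ε` is small enough for the nonlinear part to map the ball of radius `R ε` into half of it
  obtain ⟨ε, hε0, hε1, hε⟩ := exists_pos_mul_le (K * M) (half_pos hR)
  set ρ : ℝ≥0 := R * ε ^ 2 with hρ
  have hρ0 : 0 < ρ := by positivity
  have hρR : ρ ≤ R := mul_le_of_le_one_right zero_le (pow_le_one₀ zero_le hε1)
  -- `T` is small enough for the differential part to contract by a factor `1 / 2`
  obtain ⟨T, hT0, -, hT⟩ := exists_pos_mul_le (K * B * (1 / ρ + 1)) (half_pos one_pos)
  have hw := gevreyWeight_add_le (ι := ι) ρ T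
  have hw0 := gevreyWeight_zero (ι := ι) ρ T
  set wt : ι ⊕ Unit → ℕ := Sum.elim (fun _ => 1) fun _ => 2
  have hx1 : ∀ i : ι, (X (Sum.inl i) : MvPowerSeries (ι ⊕ Unit) ℂ) ∈ orderIdeal wt 1 :=
    fun i => X_mem_orderIdeal (Sum.inl i)
  have hsub : ∀ Y : κ → MvPowerSeries (ι ⊕ Unit) ℂ, (∀ i, Y i ∈ orderIdeal wt 1) →
      HasSubst (Sum.elim (fun l => X (Sum.inl l)) Y) := by
    intro Y hY
    refine hasSubst_of_constantCoeff_zero ?_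
    rintro (i | j)
    · exact constantCoeff_X _
    · exact constantCoeff_eq_zero_of_mem_orderIdeal (hY j)
  suffices hfix : ∃ Y, (∀ i, Y i ∈ orderIdeal wt 1) ∧
      (fun i => ∑ j, ν i j • (liftedField a h (Y j) -
        subst (Sum.elim (fun l => X (Sum.inl l)) Y) (G j))) = Y ∧
      ∀ i, wnorm (gevreyWeight ρ T) (Y i) ≤ ((R * ε : ℝ≥0) : ℝ≥0∞) by
    obtain ⟨Y, hY1, hYfix, hYn⟩ := hfix
    exact ⟨ρ, T, R * ε, hρ0, hT0, Y, fun i => constantCoeff_eq_zero_of_mem_orderIdeal (hY1 i),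
      fun i => (congrFun hYfix i).symm, hYn⟩
  refine exists_fixedPoint_of_contracting (w := wt)
    (fun Y i => ∑ j, ν i j • (liftedField a h (Y j) -
        subst (Sum.elim (fun l => X (Sum.inl l)) Y) (G j))) ?_ ?_ (gevreyWeight ρ T)
    ((R * ε : ℝ≥0) : ℝ≥0∞) ?_
  · intro Y hY i
    refine Ideal.sum_mem _ fun j _ => smul_mem_orderIdeal _ (Ideal.sub_mem _ ?_ ?_)
    · exact orderIdeal_anti (by omega) (liftedField_mem_orderIdeal a h (hY j))
    · refine mem_orderIdeal_one ?_ ?_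
      · rintro (i | _) <;> simp [wt]
      · refine constantCoeff_subst_eq_zero (hsub Y hY) ?_ (hG0 j)
        rintro (i | j)
        · exact constantCoeff_X _
        · exact constantCoeff_eq_zero_of_mem_orderIdeal (hY j)
  · intro Y Z k hY hZ hYZ i
    simp only [← Finset.sum_sub_distrib, ← smul_sub]
    refine Ideal.sum_mem _ fun j _ => smul_mem_orderIdeal _ ?_
    rw [sub_sub_sub_comm, ← liftedField_sub]
    exact Ideal.sub_mem _ (liftedField_mem_orderIdeal a h (hYZ j))
      (subst_sub_subst_mem_of_no_linear_term hx1 hY hZ hYZ (G j) (hG1 j))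
  · intro Y hY hYn i
    have hfield : ∀ j, wnorm (gevreyWeight ρ T) (liftedField a h (Y j)) ≤
        ((B * ((T / ρ + T) * (R * ε)) : ℝ≥0) : ℝ≥0∞) := by
      intro j
      refine (wnorm_liftedField_le hρ0.ne' T a h (Y j)).trans ?_
      rw [ENNReal.coe_mul B, ENNReal.coe_mul (T / ρ + T), ← hB]
      gcongr
      · exact wnorm_radiusWeight_mono hρR _
      · exact wnorm_radiusWeight_mono hρR _
      · exact hYn j
    have hnl : ∀ j, wnorm (gevreyWeight ρ T)
        (subst (Sum.elim (fun l => X (Sum.inl l)) Y) (G j)) ≤ ((ε ^ 2 * M : ℝ≥0) : ℝ≥0∞) := by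
      intro j
      refine (wnorm_subst_le_of_weight hw hw0 (hsub Y hY) (G j) (R := R) hε1
        (Sum.elim (fun _ => 2) fun _ => 1) 2 ?_ (two_le_weight (hG0 j) (hG1 j))).trans ?_
      · rintro (l | l)
        · rw [Sum.elim_inl, Sum.elim_inl, wnorm_X]
          simp [gevreyWeight, xDegree_single_inl, hρ]
        · simpa using hYn l
      · rw [ENNReal.coe_mul, ENNReal.coe_pow, ← hM]
        gcongr
        exact Finset.single_le_sum (f := fun j => wnorm (radiusWeight R) (G j))
          (fun _ _ => zero_le) (Finset.mem_univ j)
    have hbound : K * (B * ((T / ρ + T) * (R * ε)) + ε ^ 2 * M) ≤ R * ε :=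
      calc K * (B * ((T / ρ + T) * (R * ε)) + ε ^ 2 * M)
          = (K * B * (1 / ρ + 1) * T) * (R * ε) + (K * M * ε) * ε := by
            rw [div_eq_mul_one_div T ρ]
            ring
        _ ≤ (1 / 2) * (R * ε) + (R / 2) * ε := by gcongr
        _ = R * ε := by
          rw [div_eq_mul_one_div R 2, ← NNReal.coe_inj]
          push_cast
          ring
    calc wnorm (gevreyWeight ρ T) (∑ j, ν i j • (liftedField a h (Y j) -
          subst (Sum.elim (fun l => X (Sum.inl l)) Y) (G j)))
        ≤ ∑ j, ‖ν i j‖ₑ * ((B * ((T / ρ + T) * (R * ε)) + ε ^ 2 * M : ℝ≥0) : ℝ≥0∞) := by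
          refine (wnorm_sum_le _ _).trans (Finset.sum_le_sum fun j _ => ?_)
          rw [wnorm_smul, ENNReal.coe_add]
          gcongr
          exact (wnorm_sub_le _ _).trans (add_le_add (hfield j) (hnl j))
      _ ≤ (K : ℝ≥0∞) * ((B * ((T / ρ + T) * (R * ε)) + ε ^ 2 * M : ℝ≥0) : ℝ≥0∞) := by
          rw [← Finset.sum_mul]
          gcongr
          have : ∑ j, ‖ν i j‖₊ ≤ K := Finset.single_le_sum (f := fun i => ∑ j, ‖ν i j‖₊)
            (fun _ _ => zero_le) (Finset.mem_univ i)
          simp only [enorm_eq_nnnorm]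
          exact_mod_cast this
      _ ≤ _ := by exact_mod_cast hbound

/-! ### Existence and uniqueness of the formal solution -/

/-- The substitution `t = P` carries solutions of the lifted equation to solutions of the original
one. -/
lemma substTime_fixedPoint [Fintype κ] {P h : MvPowerSeries ι ℂ} (hP : constantCoeff P = 0)
    (a : ι → MvPowerSeries ι ℂ) (hdvd : formalDerivation a P = P * h)
    (G : κ → MvPowerSeries (ι ⊕ κ) ℂ) (ν : Matrix κ κ ℂ) {Y : κ → MvPowerSeries (ι ⊕ Unit) ℂ}
    (hY0 : ∀ i, constantCoeff (Y i) = 0)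
    (hY : ∀ i, Y i = ∑ j, ν i j • (liftedField a h (Y j) -
        subst (Sum.elim (fun l => X (Sum.inl l)) Y) (G j))) (i : κ) :
    substTime P (Y i) = ∑ j, ν i j • (P * formalDerivation a (substTime P (Y j)) -
        subst (Sum.elim X fun l => substTime P (Y l)) (G j)) := by
  have hs := hasSubst_elim_X hP
  have hsub : HasSubst (Sum.elim (fun l => X (Sum.inl l)) Y) := by
    refine hasSubst_of_constantCoeff_zero ?_
    rintro (i | j)
    · exact constantCoeff_X _
    · exact hY0 j
  conv_lhs => rw [hY i]
  rw [substTime, ← coe_substAlgHom hs, map_sum]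
  refine Finset.sum_congr rfl fun j _ => ?_
  rw [map_smul, map_sub, coe_substAlgHom hs]
  congr 2
  · exact substTime_liftedField hP a hdvd (Y j)
  · rw [subst_comp_subst_apply hsub hs]
    congr 1
    funext s
    rcases s with l | l
    · exact subst_X hs (Sum.inl l)
    · rfl

/-- Uniqueness. If two solutions agree to order `k`, their difference `u` satisfies `u ≡ T u` to
order `k + 1` for the linear operator `T = ν P L`, hence `u ≡ T^s u` for all `s`; and `T^s u` is
divisible by `P^s`, because `P` divides `L(P)`. -/
lemma fixedPoint_unique [Fintype κ] {P h : MvPowerSeries ι ℂ} (hP : constantCoeff P = 0)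
    (a : ι → MvPowerSeries ι ℂ) (hdvd : formalDerivation a P = P * h)
    (G : κ → MvPowerSeries (ι ⊕ κ) ℂ)
    (hG1 : ∀ i j, coeff (Finsupp.single (Sum.inr j) 1) (G i) = 0) (ν : Matrix κ κ ℂ)
    {y z : κ → MvPowerSeries ι ℂ}
    (hy0 : ∀ i, constantCoeff (y i) = 0) (hz0 : ∀ i, constantCoeff (z i) = 0)
    (hy : ∀ i, y i = ∑ j, ν i j • (P * formalDerivation a (y j) - subst (Sum.elim X y) (G j)))
    (hz : ∀ i, z i = ∑ j, ν i j • (P * formalDerivation a (z j) - subst (Sum.elim X z) (G j))) :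
    y = z := by
  classical
  set wt : ι → ℕ := fun _ => 1
  have hwt : ∀ s, 0 < wt s := fun _ => one_pos
  have hP1 : P ∈ orderIdeal wt 1 := mem_orderIdeal_one hwt hP
  let T : (κ → MvPowerSeries ι ℂ) → κ → MvPowerSeries ι ℂ := fun u i =>
    ∑ j, ν i j • (P * formalDerivation a (u j))
  have hTsub : ∀ u v : κ → MvPowerSeries ι ℂ, T (u - v) = T u - T v := by
    intro u v
    funext i
    simp only [T, Pi.sub_apply, map_sub, mul_sub, smul_sub, Finset.sum_sub_distrib]
  have hTmem : ∀ k (u : κ → MvPowerSeries ι ℂ), (∀ i, u i ∈ orderIdeal wt k) →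
      ∀ i, T u i ∈ orderIdeal wt k := by
    intro k u hu i
    refine Ideal.sum_mem _ fun j _ => smul_mem_orderIdeal _ ?_
    rw [formalDerivation_apply, Finset.mul_sum]
    refine Ideal.sum_mem _ fun l _ => ?_
    rw [mul_left_comm]
    refine Ideal.mul_mem_left _ _ ?_
    refine orderIdeal_anti ?_ (mul_mem_orderIdeal hP1 (pderiv_mem_orderIdeal l (hu j)))
    simp only [wt]
    omega
  have hTdvd : ∀ s u i, P ^ s ∣ (T^[s] u) i := by
    intro s u
    induction s with
    | zero => simp
    | succ s ih =>
      intro i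
      rw [Function.iterate_succ_apply']
      refine Finset.dvd_sum fun j _ => ?_
      rw [smul_eq_C_mul]
      refine Dvd.dvd.mul_left ?_ _
      obtain ⟨v, hv⟩ := ih j
      rw [hv, pow_succ', Derivation.leibniz, Derivation.leibniz_pow, hdvd]
      refine mul_dvd_mul_left P (dvd_add (dvd_mul_right _ _) (Dvd.dvd.mul_left ?_ _))
      rcases s with _ | s
      · simp
      · refine dvd_nsmul_of_dvd _ ?_
        rw [Nat.add_sub_cancel, smul_eq_mul, ← mul_assoc, ← pow_succ]
        exact dvd_mul_right _ _
  have hu0 : ∀ k, ∀ i, y i - z i ∈ orderIdeal wt (k + 1) := by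
    intro k
    induction k with
    | zero =>
      exact fun i => mem_orderIdeal_one hwt (by rw [map_sub, hy0, hz0, sub_zero])
    | succ k ih =>
      set u : κ → MvPowerSeries ι ℂ := y - z with hu
      have hstep : ∀ i, (u - T u) i ∈ orderIdeal wt (k + 1 + 1) := by
        intro i
        have e : (u - T u) i = - ∑ j, ν i j •
            (subst (Sum.elim X y) (G j) - subst (Sum.elim X z) (G j)) := by
          have : u i = y i - z i := rfl
          rw [Pi.sub_apply, this, hu, hTsub, Pi.sub_apply, hy i, hz i]
          simp only [T, smul_sub, Finset.sum_sub_distrib]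
          ring
        rw [e]
        refine neg_mem (Ideal.sum_mem _ fun j _ => smul_mem_orderIdeal _ ?_)
        exact subst_sub_subst_mem_of_no_linear_term (fun i => X_mem_orderIdeal i)
          (fun i => mem_orderIdeal_one hwt (hy0 i)) (fun i => mem_orderIdeal_one hwt (hz0 i))
          ih (G j) (hG1 j)
      have hiter : ∀ s i, (u - T^[s] u) i ∈ orderIdeal wt (k + 1 + 1) := by
        intro s
        induction s with
        | zero => simp
        | succ s ihs =>
          intro i
          have := hTmem _ _ ihs i
          rw [hTsub] at this
          rw [Function.iterate_succ_apply', ← sub_add_sub_cancel u (T u)]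
          exact Ideal.add_mem _ (hstep i) this
      intro i
      have h1 := hiter (k + 1 + 1) i
      have h2 : (T^[k + 1 + 1] u) i ∈ orderIdeal wt (k + 1 + 1) :=
        Ideal.mem_of_dvd _ (hTdvd _ u i) (pow_mem_orderIdeal hP1 _)
      rw [Pi.sub_apply] at h1
      have := Ideal.add_mem _ h1 h2
      rwa [sub_add_cancel] at this
  funext i
  rw [← sub_eq_zero]
  exact eq_zero_of_forall_mem_orderIdeal (w := wt) fun k => orderIdeal_anti k.le_succ (hu0 k i)

end lift

/-! ### Taylor series of smooth germs -/

section taylor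

set_option linter.unusedSectionVars false

open scoped ContDiff

variable {ι : Type*} [Fintype ι] [DecidableEq ι]

/-- The partial derivative `∂f/∂x_j`, for an arbitrary finite index set of variables. -/
def partialD (j : ι) (f : (ι → ℂ) → ℂ) (x : ι → ℂ) : ℂ :=
  fderiv ℂ f x (Pi.single j 1)

/-- The iterated partial derivative along a list of variables, the last entry being applied
first. -/
def iterPartial (l : List ι) (f : (ι → ℂ) → ℂ) : (ι → ℂ) → ℂ :=
  l.foldr partialD f

/-- Smoothness on a neighbourhood of `x`. In the complex setting this is holomorphy near `x`; for
power series smoothness is more readily established than analyticity, and it is all that the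
calculus of Taylor series needs. -/
def SmoothNear (f : (ι → ℂ) → ℂ) (x : ι → ℂ) : Prop :=
  ∀ᶠ y in 𝓝 x, ContDiffAt ℂ ∞ f y

lemma _root_.AnalyticAt.smoothNear {f : (ι → ℂ) → ℂ} {x : ι → ℂ} (hf : AnalyticAt ℂ f x) :
    SmoothNear f x :=
  hf.eventually_analyticAt.mono fun _ h => h.contDiffAt

namespace SmoothNear

variable {f g : (ι → ℂ) → ℂ} {x : ι → ℂ}

lemma contDiffAt (hf : SmoothNear f x) : ContDiffAt ℂ ∞ f x := hf.self_of_nhds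

lemma differentiableAt (hf : SmoothNear f x) : DifferentiableAt ℂ f x :=
  hf.contDiffAt.differentiableAt (by simp)

lemma eventually (hf : SmoothNear f x) : ∀ᶠ y in 𝓝 x, SmoothNear f y :=
  eventually_eventually_nhds.2 hf

lemma mul (hf : SmoothNear f x) (hg : SmoothNear g x) : SmoothNear (fun y => f y * g y) x := by
  filter_upwards [hf, hg] with y h1 h2 using h1.mul h2

lemma partialD (hf : SmoothNear f x) (j : ι) : SmoothNear (partialD j f) x := by
  filter_upwards [hf] with y hy
  exact (hy.fderiv_right (m := ∞) (by simp)).clm_apply contDiffAt_const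

lemma iterPartial (hf : SmoothNear f x) (l : List ι) : SmoothNear (iterPartial l f) x := by
  induction l with
  | nil => exact hf
  | cons j l ih => exact ih.partialD j

end SmoothNear

lemma partialD_congr {f g : (ι → ℂ) → ℂ} {x : ι → ℂ} (h : f =ᶠ[𝓝 x] g) (j : ι) :
    partialD j f =ᶠ[𝓝 x] partialD j g := by
  filter_upwards [h.fderiv (𝕜 := ℂ)] with y hy
  rw [partialD, partialD, hy]

lemma iterPartial_congr {f g : (ι → ℂ) → ℂ} {x : ι → ℂ} (h : f =ᶠ[𝓝 x] g) (l : List ι) :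
    iterPartial l f =ᶠ[𝓝 x] iterPartial l g := by
  induction l with
  | nil => exact h
  | cons j l ih => exact partialD_congr ih j

lemma iteratedFDeriv_single_eq_iterPartial (f : (ι → ℂ) → ℂ) (l : List ι) (x : ι → ℂ)
    (hf : SmoothNear f x) :
    iteratedFDeriv ℂ l.length f x (fun k => Pi.single (l.get k) 1) = iterPartial l f x := by
  induction l generalizing x with
  | nil => simp [iterPartial]
  | cons j l ih =>
    have hdiff : DifferentiableAt ℂ (iteratedFDeriv ℂ l.length f) x :=
      (hf.contDiffAt.iteratedFDeriv_right (m := 1) (i := l.length)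
        (by exact_mod_cast le_top)).differentiableAt (by simp)
    have heq : (fun y => iteratedFDeriv ℂ l.length f y fun k => Pi.single (l.get k) 1) =ᶠ[𝓝 x]
        iterPartial l f := by
      filter_upwards [hf.eventually] with y hy using ih y hy
    change iteratedFDeriv ℂ (l.length + 1) f x (fun k => Pi.single ((j :: l).get k) 1) = _
    rw [iteratedFDeriv_succ_apply_left]
    change _ = fderiv ℂ (iterPartial l f) x (Pi.single j 1)
    rw [← heq.fderiv_eq, fderiv_continuousMultilinear_apply_const_apply hdiff]
    rfl

lemma partialD_comm {f : (ι → ℂ) → ℂ} {x : ι → ℂ} (hf : SmoothNear f x) (i j : ι) :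
    partialD i (partialD j f) x = partialD j (partialD i f) x := by
  have hd : DifferentiableAt ℂ (fderiv ℂ f) x :=
    (hf.contDiffAt.fderiv_right (m := 1)
      (WithTop.coe_le_coe.2 (le_top : (2 : ℕ∞) ≤ ⊤))).differentiableAt (by simp)
  have h : ∀ i j, partialD i (partialD j f) x =
      fderiv ℂ (fderiv ℂ f) x (Pi.single i 1) (Pi.single j 1) := by
    intro i j
    have : HasFDerivAt (partialD j f)
        ((ContinuousLinearMap.apply ℂ ℂ (Pi.single j 1)).comp (fderiv ℂ (fderiv ℂ f) x)) x :=
      (ContinuousLinearMap.apply ℂ ℂ (Pi.single j (1 : ℂ) : ι → ℂ)).hasFDerivAt.comp x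
        hd.hasFDerivAt
    rw [partialD, this.fderiv]
    rfl
  rw [h, h]
  exact (hf.contDiffAt.isSymmSndFDerivAt (by simpa using ENat.LEInfty.out)) _ _

lemma iterPartial_perm {f : (ι → ℂ) → ℂ} {l l' : List ι} (h : l.Perm l') {x : ι → ℂ}
    (hf : SmoothNear f x) : iterPartial l f x = iterPartial l' f x := by
  induction h generalizing x with
  | nil => rfl
  | cons j _ ih =>
    have : iterPartial _ f =ᶠ[𝓝 x] iterPartial _ f := hf.eventually.mono fun y hy => ih hy
    exact (partialD_congr this j).self_of_nhds
  | swap i j l => exact partialD_comm (hf.iterPartial l) j i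
  | trans _ _ ih1 ih2 => exact (ih1 hf).trans (ih2 hf)

lemma coeff_taylorSeries {f : (ι → ℂ) → ℂ} (hf : SmoothNear f 0) (β : ι →₀ ℕ) :
    coeff β (taylorSeries f) =
      iterPartial β.toMultiset.toList f 0 / ((∏ i, (β i).factorial : ℕ) : ℂ) := by
  rw [← iteratedFDeriv_single_eq_iterPartial f _ 0 hf]
  rfl

lemma constantCoeff_taylorSeries {f : (ι → ℂ) → ℂ} (hf : SmoothNear f 0) :
    constantCoeff (taylorSeries f) = f 0 := by
  rw [← coeff_zero_eq_constantCoeff_apply, coeff_taylorSeries hf]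
  simp [iterPartial]

lemma taylorSeries_congr {f g : (ι → ℂ) → ℂ} (hf : SmoothNear f 0) (h : f =ᶠ[𝓝 0] g) :
    taylorSeries f = taylorSeries g := by
  have hg : SmoothNear g 0 := by
    filter_upwards [hf, h.eventuallyEq_nhds] with y h1 h2 using h1.congr_of_eventuallyEq h2.symm
  ext β
  rw [coeff_taylorSeries hf, coeff_taylorSeries hg, (iterPartial_congr h _).self_of_nhds]

lemma pderiv_taylorSeries {f : (ι → ℂ) → ℂ} (hf : SmoothNear f 0) (j : ι) :
    pderiv ℂ j (taylorSeries f) = taylorSeries (partialD j f) := by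
  ext β
  rw [coeff_pderiv, coeff_taylorSeries hf, coeff_taylorSeries (hf.partialD j)]
  have hl : (β + Finsupp.single j 1).toMultiset.toList.Perm (β.toMultiset.toList ++ [j]) := by
    rw [← Multiset.coe_eq_coe, Multiset.coe_toList, ← Multiset.coe_add, Multiset.coe_toList]
    simp
  have hfac : (∏ i, ((β + Finsupp.single j 1 : ι →₀ ℕ) i).factorial) =
      (∏ i, (β i).factorial) * (β j + 1) := by
    rw [← Finset.mul_prod_erase _ _ (Finset.mem_univ j),
      ← Finset.mul_prod_erase _ (fun i => (β i).factorial) (Finset.mem_univ j)]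
    have : ∏ i ∈ Finset.univ.erase j, ((β + Finsupp.single j 1 : ι →₀ ℕ) i).factorial =
        ∏ i ∈ Finset.univ.erase j, (β i).factorial := by
      refine Finset.prod_congr rfl fun i hi => ?_
      rw [Finsupp.add_apply, Finsupp.single_eq_of_ne (Finset.ne_of_mem_erase hi), add_zero]
    rw [this, Finsupp.add_apply, Finsupp.single_eq_same, Nat.factorial_succ]
    ring
  rw [iterPartial_perm hl hf, hfac, iterPartial, List.foldr_append]
  have h1 : ((β j : ℂ) + 1) ≠ 0 := Nat.cast_add_one_ne_zero _
  have h2 : ((∏ i, (β i).factorial : ℕ) : ℂ) ≠ 0 :=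
    Nat.cast_ne_zero.2 (Finset.prod_ne_zero_iff.2 fun i _ => Nat.factorial_ne_zero _)
  rw [Nat.cast_mul, Nat.cast_add, Nat.cast_one]
  change iterPartial _ (partialD j f) 0 / _ * _ = _
  field_simp

lemma taylorSeries_add {f g : (ι → ℂ) → ℂ} (hf : SmoothNear f 0) (hg : SmoothNear g 0) :
    taylorSeries (fun x => f x + g x) = taylorSeries f + taylorSeries g := by
  ext β
  have h : mixedPartialAtZero (fun x => f x + g x) β =
      mixedPartialAtZero f β + mixedPartialAtZero g β := by
    rw [mixedPartialAtZero, mixedPartialAtZero, mixedPartialAtZero]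
    have := iteratedFDeriv_add_apply (𝕜 := ℂ) (x := (0 : ι → ℂ)) (f := f) (g := g)
      (i := β.toMultiset.toList.length)
      (hf.contDiffAt.of_le (by exact_mod_cast le_top))
      (hg.contDiffAt.of_le (by exact_mod_cast le_top))
    rw [show (fun x => f x + g x) = f + g from rfl, this]
    rfl
  change mixedPartialAtZero _ β / _ = mixedPartialAtZero f β / _ + mixedPartialAtZero g β / _
  rw [h, add_div]

lemma taylorSeries_zero : taylorSeries (fun _ : ι → ℂ => (0 : ℂ)) = 0 := by
  have h0 : SmoothNear (fun _ : ι → ℂ => (0 : ℂ)) 0 :=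
    Filter.Eventually.of_forall fun _ => contDiffAt_const
  have := taylorSeries_add h0 h0
  simpa using this

lemma taylorSeries_sum {α : Type*} (s : Finset α) {f : α → (ι → ℂ) → ℂ}
    (hf : ∀ i ∈ s, SmoothNear (f i) 0) :
    taylorSeries (fun x => ∑ i ∈ s, f i x) = ∑ i ∈ s, taylorSeries (f i) := by
  classical
  induction s using Finset.induction_on with
  | empty => simpa using taylorSeries_zero
  | insert i s hi ih =>
    simp only [Finset.sum_insert hi]
    have hs : ∀ k ∈ s, SmoothNear (f k) 0 := fun k hk => hf k (Finset.mem_insert_of_mem hk)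
    rw [taylorSeries_add (hf i (Finset.mem_insert_self _ _)) ?_, ih hs]
    filter_upwards [(Filter.eventually_all_finset s).2 hs] with y hy
    exact ContDiffAt.sum hy

/-- Induction on the degree of a coefficient: a coefficient of positive degree is determined by a
coefficient of lower degree of a partial derivative. -/
lemma coeff_eq_of_pderiv {f g : MvPowerSeries ι ℂ} {n : ℕ}
    (h0 : constantCoeff f = constantCoeff g)
    (h : ∀ j, ∀ β : ι →₀ ℕ, β.degree < n → coeff β (pderiv ℂ j f) = coeff β (pderiv ℂ j g))
    (β : ι →₀ ℕ) (hβ : β.degree < n + 1) : coeff β f = coeff β g := by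
  by_cases hz : β = 0
  · rw [hz, coeff_zero_eq_constantCoeff_apply, coeff_zero_eq_constantCoeff_apply, h0]
  obtain ⟨j, hj⟩ := Finsupp.ne_iff.1 hz
  obtain ⟨δ, rfl⟩ : ∃ δ, β = δ + Finsupp.single j 1 :=
    ⟨β - Finsupp.single j 1, (tsub_add_cancel_of_le
      (Finsupp.single_le_iff.2 (Nat.one_le_iff_ne_zero.2 hj))).symm⟩
  rw [map_add, Finsupp.degree_single] at hβ
  have := h j δ (by omega)
  rw [coeff_pderiv, coeff_pderiv] at this
  exact mul_right_cancel₀ (Nat.cast_add_one_ne_zero _) this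

lemma taylorSeries_mul {f g : (ι → ℂ) → ℂ} (hf : SmoothNear f 0) (hg : SmoothNear g 0) :
    taylorSeries (fun x => f x * g x) = taylorSeries f * taylorSeries g := by
  suffices h : ∀ n : ℕ, ∀ f g : (ι → ℂ) → ℂ, SmoothNear f 0 → SmoothNear g 0 →
      ∀ β : ι →₀ ℕ, β.degree < n → coeff β (taylorSeries fun x => f x * g x) =
        coeff β (taylorSeries f * taylorSeries g) by
    ext β
    exact h _ f g hf hg β (Nat.lt_succ_self _)
  intro n
  induction n with
  | zero => exact fun _ _ _ _ β hβ => absurd hβ (Nat.not_lt_zero _)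
  | succ n ih =>
    intro f g hf hg
    refine coeff_eq_of_pderiv ?_ ?_
    · rw [map_mul, constantCoeff_taylorSeries (hf.mul hg), constantCoeff_taylorSeries hf,
        constantCoeff_taylorSeries hg]
    · intro j β hβ
      have hleib : partialD j (fun x => f x * g x) =ᶠ[𝓝 0]
          fun x => f x * partialD j g x + g x * partialD j f x := by
        filter_upwards [hf.eventually, hg.eventually] with y h1 h2
        have := (h1.differentiableAt.hasFDerivAt.mul h2.differentiableAt.hasFDerivAt).fderiv
        change fderiv ℂ (f * g) y _ = _
        rw [this]
        rfl
      rw [pderiv_taylorSeries (hf.mul hg), taylorSeries_congr ((hf.mul hg).partialD j) hleib,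
        taylorSeries_add (hf.mul (hg.partialD j)) (hg.mul (hf.partialD j)), map_add,
        ih _ _ hf (hg.partialD j) β hβ, ih _ _ hg (hf.partialD j) β hβ, ← map_add,
        Derivation.leibniz, pderiv_taylorSeries hf, pderiv_taylorSeries hg]
      rfl

/-! ### Convergence of Taylor series -/

lemma tsum_half_pow_degree_ne_top :
    ∑' β : ι →₀ ℕ, ((2 : ℝ≥0∞)⁻¹) ^ β.degree ≠ ⊤ := by
  classical
  have hle : ∑' β : ι →₀ ℕ, ((2 : ℝ≥0∞)⁻¹) ^ β.degree ≤ 2 ^ Fintype.card ι := by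
    rw [← Finsupp.equivFunOnFinite.symm.tsum_eq, ENNReal.tsum_eq_iSup_sum]
    refine iSup_le fun s => ?_
    set m := s.sup fun p => ∑ i, p i + 1
    calc ∑ p ∈ s, ((2 : ℝ≥0∞)⁻¹) ^ (Finsupp.equivFunOnFinite.symm p).degree
        = ∑ p ∈ s, ∏ i, ((2 : ℝ≥0∞)⁻¹) ^ p i := by
          refine Finset.sum_congr rfl fun p _ => ?_
          rw [Finset.prod_pow_eq_pow_sum, Finsupp.degree_eq_sum]
          rfl
      _ ≤ ∑ p ∈ Fintype.piFinset fun _ : ι => Finset.range m, ∏ i, ((2 : ℝ≥0∞)⁻¹) ^ p i := by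
          refine Finset.sum_le_sum_of_subset fun p hp => ?_
          rw [Fintype.mem_piFinset]
          intro i
          rw [Finset.mem_range]
          have h1 : ∑ i, p i + 1 ≤ m := Finset.le_sup (f := fun p : ι → ℕ => ∑ i, p i + 1) hp
          have h2 : p i ≤ ∑ i, p i := Finset.single_le_sum (fun _ _ => zero_le) (Finset.mem_univ i)
          omega
      _ = ∏ _i : ι, ∑ k ∈ Finset.range m, ((2 : ℝ≥0∞)⁻¹) ^ k := by
          rw [Finset.prod_univ_sum]
      _ ≤ ∏ _i : ι, 2 := by
          refine Finset.prod_le_prod' fun i _ => (ENNReal.sum_le_tsum _).trans ?_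
          rw [ENNReal.tsum_geometric, ENNReal.one_sub_inv_two, inv_inv]
      _ = _ := by simp
  exact ne_top_of_le_ne_top (by simp) hle

lemma factorial_degree_le (β : ι →₀ ℕ) :
    β.degree.factorial ≤ Fintype.card ι ^ β.degree * ∏ i, (β i).factorial := by
  classical
  have h1 := Nat.multinomial_spec Finset.univ β
  rw [← Finsupp.degree_eq_sum] at h1
  have h2 := Finset.sum_pow_eq_sum_piAntidiag (Finset.univ : Finset ι) (fun _ => (1 : ℕ)) β.degree
  simp only [Finset.sum_const, Finset.card_univ, smul_eq_mul, mul_one, one_pow,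
    Finset.prod_const_one, Nat.cast_id] at h2
  have h3 : Nat.multinomial Finset.univ β ≤ Fintype.card ι ^ β.degree := by
    rw [h2]
    refine Finset.single_le_sum (f := fun k => Nat.multinomial Finset.univ k)
      (fun _ _ => zero_le) ?_
    rw [Finset.mem_piAntidiag]
    exact ⟨(Finsupp.degree_eq_sum β).symm, fun _ _ => Finset.mem_univ _⟩
  rw [← h1, mul_comm]
  gcongr

/-- The Taylor series of an analytic germ converges normally on some polydisc. -/
lemma exists_wnorm_taylorSeries_ne_top {f : (ι → ℂ) → ℂ} (hf : AnalyticAt ℂ f 0) :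
    ∃ R : ℝ≥0, 0 < R ∧ wnorm (radiusWeight R) (taylorSeries f) ≠ ⊤ := by
  obtain ⟨p, r, hp⟩ := hf
  obtain ⟨r', hr'0, hr'⟩ := ENNReal.lt_iff_exists_nnreal_btwn.1 hp.r_pos
  obtain ⟨C, hC, hpC⟩ := p.nnnorm_mul_pow_le_of_lt_radius (hr'.trans_le hp.r_le)
  have hr0 : 0 < r' := by exact_mod_cast hr'0
  set D : ℝ≥0 := ((Fintype.card ι : ℕ) : ℝ≥0)
  refine ⟨r' / (2 * (D + 1)), by positivity, ?_⟩
  have hcoeff : ∀ β : ι →₀ ℕ, ‖coeff β (taylorSeries f)‖₊ ≤ D ^ β.degree * ‖p β.degree‖₊ := by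
    intro β
    set l := β.toMultiset.toList with hl
    have hlen : l.length = β.degree := by
      rw [hl, Multiset.length_toList, Finsupp.card_toMultiset]
      rfl
    have h1 : ‖mixedPartialAtZero f β‖₊ ≤ (β.degree.factorial : ℝ≥0) * ‖p β.degree‖₊ := by
      rw [mixedPartialAtZero, ← hl, hp.iteratedFDeriv_eq_sum_of_completeSpace, ← hlen]
      refine (nnnorm_sum_le _ _).trans ?_
      calc ∑ σ : Equiv.Perm (Fin l.length), ‖p l.length fun i => Pi.single (l.get (σ i)) 1‖₊
          ≤ ∑ σ : Equiv.Perm (Fin l.length), ‖p l.length‖₊ := by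
            refine Finset.sum_le_sum fun σ _ => ?_
            refine ((p l.length).le_opNNNorm _).trans (mul_le_of_le_one_right zero_le ?_)
            refine Finset.prod_le_one' fun i _ => ?_
            rw [← NNReal.coe_le_coe, coe_nnnorm, NNReal.coe_one,
              pi_norm_le_iff_of_nonneg zero_le_one]
            intro k
            rw [Pi.single_apply]
            split_ifs <;> simp
        _ = _ := by
            rw [Finset.sum_const, Finset.card_univ, Fintype.card_perm, Fintype.card_fin,
              nsmul_eq_mul]
    have hfac : (0 : ℝ≥0) < ((∏ i, (β i).factorial : ℕ) : ℝ≥0) :=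
      Nat.cast_pos.2 (Finset.prod_pos fun i _ => Nat.factorial_pos _)
    change ‖mixedPartialAtZero f β / ((∏ i, (β i).factorial : ℕ) : ℂ)‖₊ ≤ _
    rw [nnnorm_div, Complex.nnnorm_natCast, div_le_iff₀ hfac]
    refine h1.trans ?_
    calc (β.degree.factorial : ℝ≥0) * ‖p β.degree‖₊
        ≤ ((Fintype.card ι ^ β.degree * ∏ i, (β i).factorial : ℕ) : ℝ≥0) * ‖p β.degree‖₊ := by
          gcongr
          exact factorial_degree_le β
      _ = _ := by
          push_cast
          ring
  have hterm : ∀ β : ι →₀ ℕ, radiusWeight (r' / (2 * (D + 1))) β * ‖coeff β (taylorSeries f)‖₊ ≤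
      C * (2⁻¹) ^ β.degree := by
    intro β
    set n := β.degree
    calc radiusWeight (r' / (2 * (D + 1))) β * ‖coeff β (taylorSeries f)‖₊
        ≤ (r' / (2 * (D + 1))) ^ n * ((D + 1) ^ n * ‖p n‖₊) := by
          rw [radiusWeight]
          gcongr
          refine (hcoeff β).trans ?_
          gcongr
          exact le_self_add
      _ = (‖p n‖₊ * r' ^ n) * (2⁻¹) ^ n := by
          rw [div_pow, mul_pow, inv_pow]
          field_simp
      _ ≤ _ := by
          gcongr
          exact hpC n
  have hle : wnorm (radiusWeight (r' / (2 * (D + 1)))) (taylorSeries f) ≤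
      C * ∑' β : ι →₀ ℕ, ((2 : ℝ≥0∞)⁻¹) ^ β.degree := by
    rw [wnorm, ← ENNReal.tsum_mul_left]
    refine ENNReal.tsum_le_tsum fun β => ?_
    have h2 : (2 : ℝ≥0∞)⁻¹ = ((2⁻¹ : ℝ≥0) : ℝ≥0∞) := by simp
    rw [h2, enorm_eq_nnnorm]
    exact_mod_cast hterm β
  exact ne_top_of_le_ne_top (ENNReal.mul_ne_top ENNReal.coe_ne_top tsum_half_pow_degree_ne_top) hle

end taylor

/-! ### Sums of convergent power series -/

section eval

set_option linter.unusedSectionVars false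

open scoped ContDiff

variable {ι : Type*} [Fintype ι]

/-- The sum of a power series at the point `x`. -/
def evalSeries (p : MvPowerSeries ι ℂ) (x : ι → ℂ) : ℂ :=
  ∑' β, coeff β p * ∏ i, x i ^ β i

/-- Normal convergence on all polydiscs of radius less than `R`. Unlike convergence of the norm for
one radius, this is stable under partial derivatives. -/
def ConvergesBelow (R : ℝ≥0) (p : MvPowerSeries ι ℂ) : Prop :=
  ∀ R' < R, wnorm (radiusWeight R') p ≠ ⊤

lemma convergesBelow_of_wnorm_ne_top {R : ℝ≥0} {p : MvPowerSeries ι ℂ}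
    (h : wnorm (radiusWeight R) p ≠ ⊤) : ConvergesBelow R p :=
  fun _ hR' => ne_top_of_le_ne_top h (wnorm_radiusWeight_mono hR'.le p)

lemma summable_of_wnorm_ne_top {R : ℝ≥0} {p : MvPowerSeries ι ℂ}
    (h : wnorm (radiusWeight R) p ≠ ⊤) :
    Summable fun β : ι →₀ ℕ => R ^ β.degree * ‖coeff β p‖₊ := by
  rw [← ENNReal.tsum_coe_ne_top_iff_summable]
  simpa [wnorm, radiusWeight, enorm_eq_nnnorm] using h

lemma nnnorm_term_le (p : MvPowerSeries ι ℂ) {R : ℝ≥0} {x : ι → ℂ} (hx : ∀ i, ‖x i‖₊ ≤ R)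
    (β : ι →₀ ℕ) : ‖coeff β p * ∏ i, x i ^ β i‖₊ ≤ R ^ β.degree * ‖coeff β p‖₊ := by
  rw [nnnorm_mul, mul_comm]
  gcongr
  rw [nnnorm_prod, Finsupp.degree_eq_sum, ← Finset.prod_pow_eq_pow_sum]
  refine Finset.prod_le_prod' fun i _ => ?_
  rw [nnnorm_pow]
  gcongr
  exact hx i

lemma enorm_evalSeries_le {R : ℝ≥0} (p : MvPowerSeries ι ℂ) {x : ι → ℂ} (hx : ∀ i, ‖x i‖₊ ≤ R) :
    ‖evalSeries p x‖ₑ ≤ wnorm (radiusWeight R) p := by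
  refine (enorm_tsum_le_tsum_enorm).trans (ENNReal.tsum_le_tsum fun β => ?_)
  rw [enorm_eq_nnnorm, enorm_eq_nnnorm, radiusWeight, ← ENNReal.coe_mul]
  exact_mod_cast nnnorm_term_le p hx β

lemma evalSeries_zero (p : MvPowerSeries ι ℂ) : evalSeries p 0 = constantCoeff p := by
  rw [evalSeries, tsum_eq_single 0, coeff_zero_eq_constantCoeff_apply]
  · simp
  · intro β hβ
    obtain ⟨i, hi⟩ := Finsupp.ne_iff.1 hβ
    rw [Finset.prod_eq_zero (Finset.mem_univ i), mul_zero]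
    simpa using hi

lemma succ_mul_pow_mul_sub_le {a b : ℝ≥0} (hab : a ≤ b) (n : ℕ) :
    (n + 1) * a ^ n * (b - a) ≤ b ^ (n + 1) := by
  induction n with
  | zero => simp
  | succ n ih =>
    calc ((n + 1 : ℕ) + 1) * a ^ (n + 1) * (b - a)
        = a * ((n + 1) * a ^ n * (b - a)) + a ^ (n + 1) * (b - a) := by
          push_cast
          ring
      _ ≤ a * b ^ (n + 1) + b ^ (n + 1) * (b - a) := by gcongr
      _ = b ^ (n + 1) * (a + (b - a)) := by ring
      _ = b ^ (n + 1 + 1) := by rw [add_tsub_cancel_of_le hab, pow_succ b (n + 1)]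

lemma ConvergesBelow.pderiv {R : ℝ≥0} {p : MvPowerSeries ι ℂ} (h : ConvergesBelow R p) (j : ι) :
    ConvergesBelow R (pderiv ℂ j p) := by
  intro R' hR'
  obtain ⟨R'', h1, h2⟩ := exists_between hR'
  refine ne_top_of_le_ne_top (ENNReal.mul_ne_top ENNReal.coe_ne_top (h R'' h2))
    (wnorm_pderiv_le (c := (R'' - R')⁻¹) (w' := radiusWeight R'') (fun γ => ?_) p)
  have hpos : 0 < R'' - R' := tsub_pos_of_lt h1
  rw [radiusWeight, radiusWeight, map_add, Finsupp.degree_single, inv_mul_eq_div,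
    le_div_iff₀ hpos]
  refine le_trans ?_ (succ_mul_pow_mul_sub_le h1.le γ.degree)
  rw [mul_comm (R' ^ _)]
  gcongr
  exact Finsupp.le_degree j γ

variable [DecidableEq ι]

/-- The differential of the monomial `c x^β`. -/
def monomialDeriv (c : ℂ) (β : ι →₀ ℕ) (x : ι → ℂ) : (ι → ℂ) →L[ℂ] ℂ :=
  c • ∑ j, (∏ i ∈ Finset.univ.erase j, x i ^ β i) •
    ((β j : ℂ) * x j ^ (β j - 1)) • (ContinuousLinearMap.proj j : (ι → ℂ) →L[ℂ] ℂ)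

lemma hasFDerivAt_monomial (c : ℂ) (β : ι →₀ ℕ) (x : ι → ℂ) :
    HasFDerivAt (fun x : ι → ℂ => c * ∏ i, x i ^ β i) (monomialDeriv c β x) x := by
  refine HasFDerivAt.const_mul ?_ c
  refine HasFDerivAt.finsetProd (u := Finset.univ) (g := fun i (x : ι → ℂ) => x i ^ β i)
    fun i _ => ?_
  simpa using (hasFDerivAt_apply (𝕜 := ℂ) i x).pow (β i)

lemma norm_monomialDeriv_le (c : ℂ) (β : ι →₀ ℕ) {R : ℝ≥0} {x : ι → ℂ} (hx : ∀ i, ‖x i‖₊ ≤ R) :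
    ‖monomialDeriv c β x‖₊ ≤ ‖c‖₊ * (β.degree * R ^ (β.degree - 1)) := by
  rw [monomialDeriv, nnnorm_smul]
  gcongr
  refine (nnnorm_sum_le _ _).trans ?_
  have hd : (β.degree : ℝ≥0) * R ^ (β.degree - 1) = ∑ j, (β j : ℝ≥0) * R ^ (β.degree - 1) := by
    rw [← Finset.sum_mul]
    congr 1
    rw [Finsupp.degree_eq_sum]
    push_cast
    rfl
  rw [hd]
  refine Finset.sum_le_sum fun j _ => ?_
  rcases Nat.eq_zero_or_pos (β j) with h0 | hpos
  · rw [nnnorm_smul, nnnorm_smul, h0]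
    simp
  have hproj : ‖(ContinuousLinearMap.proj j : (ι → ℂ) →L[ℂ] ℂ)‖₊ ≤ 1 :=
    ContinuousLinearMap.opNNNorm_le_bound _ _ fun v => by
      rw [one_mul]
      exact nnnorm_le_pi_nnnorm v j
  have hdeg : β.degree - 1 = (∑ i ∈ Finset.univ.erase j, β i) + (β j - 1) := by
    rw [Finsupp.degree_eq_sum, ← Finset.add_sum_erase _ _ (Finset.mem_univ j)]
    omega
  rw [nnnorm_smul, nnnorm_smul, nnnorm_mul, nnnorm_pow, Complex.nnnorm_natCast, hdeg, pow_add,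
    nnnorm_prod, ← Finset.prod_pow_eq_pow_sum]
  calc (∏ i ∈ Finset.univ.erase j, ‖x i ^ β i‖₊) *
        ((β j : ℝ≥0) * ‖x j‖₊ ^ (β j - 1) * ‖(ContinuousLinearMap.proj j : (ι → ℂ) →L[ℂ] ℂ)‖₊)
      ≤ (∏ i ∈ Finset.univ.erase j, R ^ β i) * ((β j : ℝ≥0) * R ^ (β j - 1) * 1) := by
        gcongr with i _
        · rw [nnnorm_pow]
          gcongr
          exact hx i
        · exact hx j
    _ = _ := by ring

lemma monomialDeriv_single (p : MvPowerSeries ι ℂ) (x : ι → ℂ) (j : ι) :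
    ∑' β, monomialDeriv (coeff β p) β x (Pi.single j 1) = evalSeries (pderiv ℂ j p) x := by
  have hval : ∀ β : ι →₀ ℕ, monomialDeriv (coeff β p) β x (Pi.single j 1) =
      coeff β p * ((∏ i ∈ Finset.univ.erase j, x i ^ β i) * ((β j : ℂ) * x j ^ (β j - 1))) := by
    intro β
    rw [monomialDeriv]
    simp only [smul_apply, sum_apply, ContinuousLinearMap.proj_apply,
      smul_eq_mul]
    rw [Finset.sum_eq_single j]
    · simp
    · intro i _ hij
      simp [Pi.single_eq_of_ne hij]
    · simp
  have inj : Function.Injective fun β : ι →₀ ℕ => β + Finsupp.single j 1 := add_left_injective _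
  rw [evalSeries, ← inj.tsum_eq]
  · refine tsum_congr fun β => ?_
    rw [hval, coeff_pderiv, ← Finset.mul_prod_erase _ _ (Finset.mem_univ j)]
    have : ∏ i ∈ Finset.univ.erase j, x i ^ ((β + Finsupp.single j 1 : ι →₀ ℕ) i) =
        ∏ i ∈ Finset.univ.erase j, x i ^ β i := by
      refine Finset.prod_congr rfl fun i hi => ?_
      rw [Finsupp.add_apply, Finsupp.single_eq_of_ne (Finset.ne_of_mem_erase hi), add_zero]
    rw [this, Finsupp.add_apply, Finsupp.single_eq_same, Nat.add_sub_cancel]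
    push_cast
    ring
  · intro β hβ
    by_contra hn
    apply hβ
    have h0 : β j = 0 := by
      by_contra h0
      exact hn ⟨β - Finsupp.single j 1, tsub_add_cancel_of_le
        (Finsupp.single_le_iff.2 (Nat.one_le_iff_ne_zero.2 h0))⟩
    change monomialDeriv (coeff β p) β x (Pi.single j 1) = 0
    rw [hval, h0]
    simp

/-- Termwise differentiation. -/
lemma ConvergesBelow.hasFDerivAt {R : ℝ≥0} {p : MvPowerSeries ι ℂ} (h : ConvergesBelow R p)
    {x : ι → ℂ} (hx : x ∈ Metric.ball (0 : ι → ℂ) R) :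
    HasFDerivAt (evalSeries p)
      (∑ j, evalSeries (MvPowerSeries.pderiv ℂ j p) x •
        (ContinuousLinearMap.proj j : (ι → ℂ) →L[ℂ] ℂ)) x := by
  rw [mem_ball_zero_iff] at hx
  obtain ⟨R', h1, hR'⟩ : ∃ R' : ℝ≥0, ‖x‖₊ < R' ∧ R' < R := exists_between (by exact_mod_cast hx)
  obtain ⟨R'', h2, h3⟩ := exists_between hR'
  have hpos : 0 < R'' - R' := tsub_pos_of_lt h2
  have hbd : ∀ y ∈ Metric.ball (0 : ι → ℂ) R', ∀ i, ‖y i‖₊ ≤ R' := by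
    intro y hy i
    rw [mem_ball_zero_iff] at hy
    exact (nnnorm_le_pi_nnnorm y i).trans (by exact_mod_cast hy.le)
  have hxs : x ∈ Metric.ball (0 : ι → ℂ) R' := by
    rw [mem_ball_zero_iff]
    exact_mod_cast h1
  have hu : Summable fun β : ι →₀ ℕ => ‖coeff β p‖₊ * (β.degree * R' ^ (β.degree - 1)) := by
    refine NNReal.summable_of_le (fun β => ?_)
      ((summable_of_wnorm_ne_top (h R'' h3)).mul_left (R'' - R')⁻¹)
    have hle : (β.degree : ℝ≥0) * R' ^ (β.degree - 1) ≤ (R'' - R')⁻¹ * R'' ^ β.degree := by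
      rw [inv_mul_eq_div, le_div_iff₀ hpos]
      rcases hn : β.degree with _ | n
      · simp
      · simpa using succ_mul_pow_mul_sub_le h2.le n
    calc _ ≤ ‖coeff β p‖₊ * ((R'' - R')⁻¹ * R'' ^ β.degree) := by gcongr
      _ = _ := by ring
  have hu' : Summable fun β : ι →₀ ℕ =>
      ((‖coeff β p‖₊ * (β.degree * R' ^ (β.degree - 1)) : ℝ≥0) : ℝ) := NNReal.summable_coe.2 hu
  have hle : ∀ β : ι →₀ ℕ, ∀ y ∈ Metric.ball (0 : ι → ℂ) R', ‖monomialDeriv (coeff β p) β y‖ ≤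
      ((‖coeff β p‖₊ * (β.degree * R' ^ (β.degree - 1)) : ℝ≥0) : ℝ) := fun β y hy => by
    exact_mod_cast norm_monomialDeriv_le _ _ (hbd y hy)
  have hsum : Summable fun β : ι →₀ ℕ => coeff β p * ∏ i, x i ^ β i := by
    refine Summable.of_nnnorm_bounded (summable_of_wnorm_ne_top (h R' hR')) fun β => ?_
    exact nnnorm_term_le p (hbd x hxs) β
  have hd := hasFDerivAt_tsum_of_isPreconnected (𝕜 := ℂ) hu' Metric.isOpen_ball
    (convex_ball (0 : ι → ℂ) R').isPreconnected
    (fun β y _ => hasFDerivAt_monomial (coeff β p) β y) hle hxs hsum hxs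
  have hsd : Summable fun β : ι →₀ ℕ => monomialDeriv (coeff β p) β x :=
    Summable.of_norm_bounded hu' fun β => hle β x hxs
  have heq : (∑ j, evalSeries (MvPowerSeries.pderiv ℂ j p) x •
      (ContinuousLinearMap.proj j : (ι → ℂ) →L[ℂ] ℂ)) = ∑' β, monomialDeriv (coeff β p) β x := by
    refine ContinuousLinearMap.coe_inj.1 (LinearMap.pi_ext fun j c => ?_)
    have e1 : (∑' β, monomialDeriv (coeff β p) β x) (Pi.single j 1) =
        evalSeries (MvPowerSeries.pderiv ℂ j p) x := by
      rw [← monomialDeriv_single]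
      exact (ContinuousLinearMap.apply ℂ ℂ (Pi.single j (1 : ℂ) : ι → ℂ)).map_tsum hsd
    have e2 : (∑ k, evalSeries (MvPowerSeries.pderiv ℂ k p) x •
        (ContinuousLinearMap.proj k : (ι → ℂ) →L[ℂ] ℂ)) (Pi.single j 1) =
        evalSeries (MvPowerSeries.pderiv ℂ j p) x := by
      simp only [sum_apply, smul_apply, ContinuousLinearMap.proj_apply,
        smul_eq_mul]
      rw [Finset.sum_eq_single j]
      · simp
      · intro i _ hij
        simp [Pi.single_eq_of_ne hij]
      · simp
    have hc : (Pi.single j c : ι → ℂ) = c • Pi.single j 1 := by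
      rw [← Pi.single_smul, smul_eq_mul, mul_one]
    rw [hc, map_smul, map_smul]
    exact congrArg (c • ·) (e2.trans e1.symm)
  rw [heq]
  exact hd

lemma ConvergesBelow.contDiffOn {R : ℝ≥0} {p : MvPowerSeries ι ℂ} (h : ConvergesBelow R p) :
    ContDiffOn ℂ ∞ (evalSeries p) (Metric.ball (0 : ι → ℂ) R) := by
  rw [contDiffOn_infty]
  intro n
  induction n generalizing p with
  | zero =>
    rw [Nat.cast_zero, contDiffOn_zero]
    exact fun x hx => (h.hasFDerivAt hx).continuousAt.continuousWithinAt
  | succ n ih =>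
    rw [Nat.cast_add, Nat.cast_one, contDiffOn_succ_iff_fderiv_of_isOpen Metric.isOpen_ball]
    refine ⟨fun x hx => (h.hasFDerivAt hx).differentiableAt.differentiableWithinAt, by simp, ?_⟩
    refine ContDiffOn.congr (f := fun x => ∑ j, evalSeries (MvPowerSeries.pderiv ℂ j p) x •
      (ContinuousLinearMap.proj j : (ι → ℂ) →L[ℂ] ℂ)) ?_ fun x hx => (h.hasFDerivAt hx).fderiv
    exact ContDiffOn.sum fun j _ => (ih (h.pderiv j)).smul contDiffOn_const

lemma ConvergesBelow.smoothNear {R : ℝ≥0} {p : MvPowerSeries ι ℂ} (h : ConvergesBelow R p)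
    (hR : 0 < R) : SmoothNear (evalSeries p) 0 := by
  filter_upwards [Metric.isOpen_ball.mem_nhds (Metric.mem_ball_self (x := (0 : ι → ℂ))
    (NNReal.coe_pos.2 hR))] with y hy
  exact h.contDiffOn.contDiffAt (Metric.isOpen_ball.mem_nhds hy)

/-- A convergent power series is the Taylor series of its sum. -/
lemma ConvergesBelow.taylorSeries_evalSeries {R : ℝ≥0} {p : MvPowerSeries ι ℂ}
    (h : ConvergesBelow R p) (hR : 0 < R) : taylorSeries (evalSeries p) = p := by
  suffices hs : ∀ n : ℕ, ∀ p : MvPowerSeries ι ℂ, ConvergesBelow R p →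
      ∀ β : ι →₀ ℕ, β.degree < n → coeff β (taylorSeries (evalSeries p)) = coeff β p by
    ext β
    exact hs _ p h β (Nat.lt_succ_self _)
  intro n
  induction n with
  | zero => exact fun _ _ β hβ => absurd hβ (Nat.not_lt_zero _)
  | succ n ih =>
    intro p h
    refine coeff_eq_of_pderiv ?_ fun j β hβ => ?_
    · rw [constantCoeff_taylorSeries (h.smoothNear hR), evalSeries_zero]
    · have hpd : partialD j (evalSeries p) =ᶠ[𝓝 0] evalSeries (MvPowerSeries.pderiv ℂ j p) := by
        filter_upwards [Metric.isOpen_ball.mem_nhds (Metric.mem_ball_self (x := (0 : ι → ℂ))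
          (NNReal.coe_pos.2 hR))] with y hy
        rw [partialD, (h.hasFDerivAt hy).fderiv]
        simp only [sum_apply, smul_apply, ContinuousLinearMap.proj_apply,
          smul_eq_mul]
        rw [Finset.sum_eq_single j]
        · simp
        · intro i _ hij
          simp [Pi.single_eq_of_ne hij]
        · simp
      rw [pderiv_taylorSeries (h.smoothNear hR),
        taylorSeries_congr ((h.smoothNear hR).partialD j) hpd, ih _ (h.pderiv j) β hβ]

end eval

/-! ### Expansion in powers of `P` -/

section timeCoeff

set_option linter.unusedSectionVars false

variable {ι : Type*} [Fintype ι]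

/-- The coefficient of `t^n` in a power series in `(x, t)`. -/
def timeCoeff (n : ℕ) (f : MvPowerSeries (ι ⊕ Unit) ℂ) : MvPowerSeries ι ℂ :=
  fun α => coeff (Finsupp.sumElim α (Finsupp.single () n)) f

lemma coeff_timeCoeff (n : ℕ) (f : MvPowerSeries (ι ⊕ Unit) ℂ) (α : ι →₀ ℕ) :
    coeff α (timeCoeff n f) = coeff (Finsupp.sumElim α (Finsupp.single () n)) f := rfl

/-- Finiteness of the Gevrey norm gives factorial growth of the coefficients, at the price of
halving the radius: `(n + k)! ≤ 2^(n+k) n! k!`. -/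
lemma wnorm_timeCoeff_le {ρ T : ℝ≥0} (hT : 0 < T) (n : ℕ) (f : MvPowerSeries (ι ⊕ Unit) ℂ) :
    wnorm (radiusWeight (ρ / 2)) (timeCoeff n f) ≤
      ((2 / T) ^ n * n.factorial : ℝ≥0) * wnorm (gevreyWeight ρ T) f := by
  have inj : Function.Injective fun α : ι →₀ ℕ => Finsupp.sumElim α (Finsupp.single () n) := by
    intro α α' h
    ext i
    exact DFunLike.congr_fun h (Sum.inl i)
  calc wnorm (radiusWeight (ρ / 2)) (timeCoeff n f)
      ≤ ∑' α : ι →₀ ℕ, (((2 / T) ^ n * n.factorial : ℝ≥0) : ℝ≥0∞) *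
          ((gevreyWeight ρ T (Finsupp.sumElim α (Finsupp.single () n)) : ℝ≥0∞) *
            ‖coeff (Finsupp.sumElim α (Finsupp.single () n)) f‖ₑ) := by
        refine ENNReal.tsum_le_tsum fun α => ?_
        rw [coeff_timeCoeff, ← mul_assoc, ← ENNReal.coe_mul]
        refine mul_le_mul_left ?_ _
        rw [ENNReal.coe_le_coe]
        set k := α.degree with hk
        have e : gevreyWeight ρ T (Finsupp.sumElim α (Finsupp.single () n)) =
            ρ ^ k * T ^ n * (k.factorial / (n + k).factorial) := by
          simp [gevreyWeight, xDegree, hk, Finsupp.degree_eq_sum]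
        have hch : ((n + k).factorial : ℝ≥0) ≤ 2 ^ (n + k) * (n.factorial * k.factorial) := by
          have h1 := Nat.add_choose_mul_factorial_mul_factorial n k
          have h2 := Nat.choose_le_two_pow (n + k) k
          rw [mul_assoc] at h1
          rw [← h1]
          push_cast
          gcongr
          exact_mod_cast h2
        rw [e, radiusWeight]
        have hf : (0 : ℝ≥0) < (n + k).factorial := by exact_mod_cast Nat.factorial_pos _
        calc (ρ / 2) ^ k = ρ ^ k / 2 ^ k * ((n + k).factorial / (n + k).factorial) := by
              rw [div_self hf.ne', mul_one, div_pow]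
          _ ≤ ρ ^ k / 2 ^ k * (2 ^ (n + k) * (n.factorial * k.factorial) / (n + k).factorial) := by
              gcongr
          _ = (2 / T) ^ n * n.factorial * (ρ ^ k * T ^ n * (k.factorial / (n + k).factorial)) := by
              rw [div_pow, pow_add]
              field_simp
    _ = (((2 / T) ^ n * n.factorial : ℝ≥0) : ℝ≥0∞) * ∑' α : ι →₀ ℕ,
          ((gevreyWeight ρ T (Finsupp.sumElim α (Finsupp.single () n)) : ℝ≥0∞) *
            ‖coeff (Finsupp.sumElim α (Finsupp.single () n)) f‖ₑ) := ENNReal.tsum_mul_left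
    _ ≤ _ := by
        gcongr
        exact ENNReal.tsum_comp_le_tsum_of_injective inj
          (fun γ => (gevreyWeight ρ T γ : ℝ≥0∞) * ‖coeff γ f‖ₑ)

lemma timeCoeff_add (n : ℕ) (f g : MvPowerSeries (ι ⊕ Unit) ℂ) :
    timeCoeff n (f + g) = timeCoeff n f + timeCoeff n g := by
  ext α
  simp [coeff_timeCoeff]

lemma timeCoeff_smul (n : ℕ) (c : ℂ) (f : MvPowerSeries (ι ⊕ Unit) ℂ) :
    timeCoeff n (c • f) = c • timeCoeff n f := by
  ext α
  simp [coeff_timeCoeff]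

lemma timeCoeff_mem_orderIdeal {n m : ℕ} {f : MvPowerSeries (ι ⊕ Unit) ℂ}
    (hf : f ∈ orderIdeal (fun _ => 1) m) : timeCoeff n f ∈ orderIdeal (fun _ => 1) (m - n) := by
  refine mem_orderIdeal.2 fun α hα => ?_
  rw [coeff_timeCoeff]
  refine mem_orderIdeal.1 hf _ ?_
  have h1 : ∀ {σ : Type _} (γ : σ →₀ ℕ), Finsupp.weight (fun _ => 1) γ = γ.degree := fun γ => by
    rw [Finsupp.degree_eq_weight_one]
  rw [h1, Finsupp.degree_eq_sum] at hα ⊢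
  rw [Fintype.sum_sum_type]
  simp
  omega

/-- The coefficients of `∑_n y_n P^n`, where only the terms with `n ≤ |β|` contribute. -/
lemma coeff_substTime {P : MvPowerSeries ι ℂ} (hP : constantCoeff P = 0)
    (f : MvPowerSeries (ι ⊕ Unit) ℂ) (β : ι →₀ ℕ) :
    coeff β (substTime P f) =
      ∑ n ∈ Finset.range (β.degree + 1), coeff β (timeCoeff n f * P ^ n) := by
  classical
  have hs := hasSubst_elim_X hP
  have hP1 : P ∈ orderIdeal (fun _ => 1) 1 := mem_orderIdeal_one (fun _ => one_pos) hP
  have hw : Finsupp.weight (fun _ => 1) β = β.degree := by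
    rw [Finsupp.degree_eq_weight_one]
  let D : MvPowerSeries (ι ⊕ Unit) ℂ →ₗ[ℂ] ℂ :=
    { toFun := fun f => coeff β (substTime P f) -
        ∑ n ∈ Finset.range (β.degree + 1), coeff β (timeCoeff n f * P ^ n)
      map_add' := fun f g => by
        simp only [substTime, subst_add hs, timeCoeff_add, add_mul, map_add,
          Finset.sum_add_distrib]
        ring
      map_smul' := fun c f => by
        simp only [substTime, subst_smul hs, timeCoeff_smul, smul_mul_assoc, map_smul,
          ← Finset.smul_sum, ← smul_sub, RingHom.id_apply] }
  have hD : ∀ g, D g = coeff β (substTime P g) -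
      ∑ n ∈ Finset.range (β.degree + 1), coeff β (timeCoeff n g * P ^ n) := fun _ => rfl
  suffices h : D f = 0 from sub_eq_zero.1 h
  refine linearMap_eq_zero D (β.degree + 1) (fun g hg => ?_) (fun p => ?_) f
  · have h1 : coeff β (substTime P g) = 0 := by
      refine mem_orderIdeal.1 (subst_mem_orderIdeal (w := fun _ => 1) hs ?_ hg) β (by omega)
      exact fun s => mem_orderIdeal_one (fun _ => one_pos) (constantCoeff_elim_X_eq_zero hP s)
    have h2 : ∑ n ∈ Finset.range (β.degree + 1), coeff β (timeCoeff n g * P ^ n) = 0 := by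
      refine Finset.sum_eq_zero fun n _ => ?_
      exact mem_orderIdeal.1 (mul_mem_orderIdeal (timeCoeff_mem_orderIdeal hg)
        (pow_mem_orderIdeal hP1 n)) β (by omega)
    rw [hD, h1, h2, sub_zero]
  · induction p using MvPolynomial.induction_on' with
    | add p q hp hq => rw [MvPolynomial.coe_add, map_add, hp, hq, add_zero]
    | monomial γ c =>
      rw [MvPolynomial.coe_monomial]
      set α : ι →₀ ℕ := Finsupp.equivFunOnFinite.symm fun i => γ (Sum.inl i) with hα
      set m := γ (Sum.inr ()) with hm
      have hγ : γ = Finsupp.sumElim α (Finsupp.single () m) := by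
        ext (i | i)
        · simp [hα]
        · simp [hm]
      have h1 : substTime P (monomial γ c) = monomial α c * P ^ m := by
        rw [substTime, subst_monomial hs, Finsupp.prod_fintype _ _ (by simp),
          Fintype.prod_sum_type, show monomial α c = c • monomial α (1 : ℂ) by
            rw [← map_smul, smul_eq_mul, mul_one], monomial_one_eq,
          Finsupp.prod_fintype _ _ (by simp), ← Algebra.smul_def, smul_mul_assoc]
        simp [hα, hm]
      have h2 : ∀ n, timeCoeff n (monomial γ c) = if n = m then monomial α c else 0 := by
        intro n
        ext δ
        rw [coeff_timeCoeff, coeff_monomial, hγ]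
        split_ifs with h3 h4 h4
        · have : δ = α := by
            ext i
            exact DFunLike.congr_fun h3 (Sum.inl i)
          rw [this, coeff_monomial_same]
        · exact absurd (by simpa using DFunLike.congr_fun h3 (Sum.inr ())) h4
        · rw [coeff_monomial_ne]
          rintro rfl
          exact h3 (by rw [h4])
        · simp
      rw [hD]
      simp only [h1, h2, ite_mul, zero_mul]
      rw [sub_eq_zero]
      simp only [apply_ite (coeff β), map_zero, Finset.sum_ite_eq', Finset.mem_range]
      split_ifs with h5
      · rfl
      · exact mem_orderIdeal.1 (Ideal.mul_mem_left _ _ (pow_mem_orderIdeal hP1 m)) β (by omega)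

lemma hasSum_coeff_substTime {P : MvPowerSeries ι ℂ} (hP : constantCoeff P = 0)
    (f : MvPowerSeries (ι ⊕ Unit) ℂ) (β : ι →₀ ℕ) :
    HasSum (fun n => coeff β (timeCoeff n f * P ^ n)) (coeff β (substTime P f)) := by
  rw [coeff_substTime hP]
  refine hasSum_sum_of_ne_finset_zero fun n hn => ?_
  have hP1 : P ∈ orderIdeal (fun _ => 1) 1 := mem_orderIdeal_one (fun _ => one_pos) hP
  refine mem_orderIdeal.1 (Ideal.mul_mem_left _ _ (pow_mem_orderIdeal hP1 n)) β ?_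
  have hw : Finsupp.weight (fun _ => 1) β = β.degree := by
    rw [Finsupp.degree_eq_weight_one]
  rw [Finset.mem_range] at hn
  omega

end timeCoeff

/-! ### The formal system attached to the germs -/

section system

variable {d N : ℕ}

lemma eventually_wnorm_taylorSeries_ne_top {ι : Type*} [Fintype ι] [DecidableEq ι]
    {f : (ι → ℂ) → ℂ} (hf : AnalyticAt ℂ f 0) :
    ∀ᶠ R in 𝓝[>] (0 : ℝ≥0), wnorm (radiusWeight R) (taylorSeries f) ≠ ⊤ := by
  obtain ⟨R₀, h0, hR₀⟩ := exists_wnorm_taylorSeries_ne_top hf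
  filter_upwards [Ioo_mem_nhdsGT h0] with R hR
  exact ne_top_of_le_ne_top hR₀ (wnorm_radiusWeight_mono hR.2.le _)

lemma formalField_eq (a : Fin d → (Fin d → ℂ) → ℂ) (g : MvPowerSeries (Fin d) ℂ) :
    formalField a g = formalDerivation (fun j => taylorSeries (a j)) g :=
  (formalDerivation_apply _ _).symm

/-- Divisibility of germs passes to Taylor series. -/
lemma formalDerivation_taylorSeries {P h : (Fin d → ℂ) → ℂ} {a : Fin d → (Fin d → ℂ) → ℂ}
    (hP : AnalyticAt ℂ P 0) (ha : ∀ j, AnalyticAt ℂ (a j) 0) (hh : AnalyticAt ℂ h 0)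
    (hdvd : ∀ᶠ x in 𝓝 (0 : Fin d → ℂ), applyField a P x = P x * h x) :
    formalDerivation (fun j => taylorSeries (a j)) (taylorSeries P) =
      taylorSeries P * taylorSeries h := by
  have hterm : ∀ j, SmoothNear (fun x => a j x * partialD j P x) 0 := fun j =>
    (ha j).smoothNear.mul (hP.smoothNear.partialD j)
  rw [← taylorSeries_mul hP.smoothNear hh.smoothNear,
    taylorSeries_congr (hP.smoothNear.mul hh.smoothNear) (hdvd.mono fun x hx => hx.symm)]
  change _ = taylorSeries fun x => ∑ j, a j x * partialD j P x
  rw [taylorSeries_sum _ fun j _ => hterm j, formalDerivation_apply]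
  refine Finset.sum_congr rfl fun j _ => ?_
  rw [taylorSeries_mul (ha j).smoothNear (hP.smoothNear.partialD j),
    pderiv_taylorSeries hP.smoothNear]

/-- The `i`-th component of `F` as a function of the joint variables `(x, y)`. -/
def jointComponent (F : (Fin d → ℂ) × (Fin N → ℂ) → (Fin N → ℂ)) (i : Fin N)
    (z : Fin d ⊕ Fin N → ℂ) : ℂ :=
  F (fun j => z (Sum.inl j), fun k => z (Sum.inr k)) i

lemma taylorSeriesXY_eq (F : (Fin d → ℂ) × (Fin N → ℂ) → (Fin N → ℂ)) (i : Fin N) :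
    taylorSeriesXY F i = taylorSeries (jointComponent F i) := rfl

/-- The continuous linear map from the joint variables to the pairs `(x, y)`. -/
def jointMap (d N : ℕ) : (Fin d ⊕ Fin N → ℂ) →L[ℂ] (Fin d → ℂ) × (Fin N → ℂ) :=
  (ContinuousLinearMap.pi fun j => ContinuousLinearMap.proj (Sum.inl j)).prod
    (ContinuousLinearMap.pi fun k => ContinuousLinearMap.proj (Sum.inr k))

lemma analyticAt_jointComponent {F : (Fin d → ℂ) × (Fin N → ℂ) → (Fin N → ℂ)}
    (hF : AnalyticAt ℂ F 0) (i : Fin N) : AnalyticAt ℂ (jointComponent F i) 0 := by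
  have h1 : AnalyticAt ℂ (fun z => F (jointMap d N z)) 0 :=
    AnalyticAt.comp (g := F) (by rwa [map_zero]) ((jointMap d N).analyticAt 0)
  exact ((ContinuousLinearMap.proj (R := ℂ) (φ := fun _ : Fin N => ℂ) i).analyticAt _).comp h1

lemma partialD_jointComponent {F : (Fin d → ℂ) × (Fin N → ℂ) → (Fin N → ℂ)}
    (hF : AnalyticAt ℂ F 0) (i j : Fin N) :
    partialD (Sum.inr j) (jointComponent F i) 0 = jacobianY F i j := by
  have hd : HasFDerivAt F (fderiv ℂ F 0) 0 := hF.differentiableAt.hasFDerivAt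
  have h1 : HasFDerivAt (fun z => F (jointMap d N z))
      ((fderiv ℂ F 0).comp (jointMap d N)) 0 :=
    HasFDerivAt.comp (g := F) (f := jointMap d N) 0 (by rwa [map_zero])
      (jointMap d N).hasFDerivAt
  have h2 : HasFDerivAt (jointComponent F i)
      ((ContinuousLinearMap.proj (R := ℂ) (φ := fun _ : Fin N => ℂ) i).comp
        ((fderiv ℂ F 0).comp (jointMap d N))) 0 :=
    (ContinuousLinearMap.proj (R := ℂ) (φ := fun _ : Fin N => ℂ) i).hasFDerivAt.comp _ h1
  have h3 : HasFDerivAt (fun y : Fin N → ℂ => F (0, y))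
      ((fderiv ℂ F 0).comp (ContinuousLinearMap.inr ℂ (Fin d → ℂ) (Fin N → ℂ))) 0 :=
    HasFDerivAt.comp (g := F) (f := ContinuousLinearMap.inr ℂ (Fin d → ℂ) (Fin N → ℂ)) 0
      (by rwa [map_zero]) (ContinuousLinearMap.hasFDerivAt _)
  have h4 : jointMap d N (Pi.single (Sum.inr j) 1) = (0, Pi.single j 1) := by
    ext k
    · simp [jointMap]
    · simp [jointMap, Pi.single_apply]
  rw [partialD, h2.fderiv, jacobianY, Matrix.of_apply, h3.fderiv]
  simp [h4]

/-- The nonlinear part `F - μ y` of the system, as a vector of power series. -/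
def nonlinearPart (F : (Fin d → ℂ) × (Fin N → ℂ) → (Fin N → ℂ)) (i : Fin N) :
    MvPowerSeries (Fin d ⊕ Fin N) ℂ :=
  taylorSeriesXY F i - ∑ j, jacobianY F i j • X (Sum.inr j)

lemma constantCoeff_nonlinearPart {F : (Fin d → ℂ) × (Fin N → ℂ) → (Fin N → ℂ)}
    (hF : AnalyticAt ℂ F 0) (hF0 : F (0, 0) = 0) (i : Fin N) :
    constantCoeff (nonlinearPart F i) = 0 := by
  have h : jointComponent F i 0 = 0 := congrFun hF0 i
  rw [nonlinearPart, map_sub, taylorSeriesXY_eq,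
    constantCoeff_taylorSeries (analyticAt_jointComponent hF i).smoothNear, h, map_sum]
  simp [smul_eq_C_mul]

lemma coeff_single_inr_nonlinearPart {F : (Fin d → ℂ) × (Fin N → ℂ) → (Fin N → ℂ)}
    (hF : AnalyticAt ℂ F 0) (i j : Fin N) :
    coeff (Finsupp.single (Sum.inr j) 1) (nonlinearPart F i) = 0 := by
  have hs := (analyticAt_jointComponent hF i).smoothNear
  have h1 : coeff (Finsupp.single (Sum.inr j) 1) (taylorSeriesXY F i) = jacobianY F i j := by
    have := coeff_pderiv (R := ℂ) (i := Sum.inr j) (taylorSeriesXY F i) 0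
    rw [zero_add, Finsupp.coe_zero, Pi.zero_apply, Nat.cast_zero, zero_add, mul_one] at this
    rw [← this, taylorSeriesXY_eq, pderiv_taylorSeries hs, coeff_zero_eq_constantCoeff_apply,
      constantCoeff_taylorSeries (hs.partialD _), partialD_jointComponent hF]
  rw [nonlinearPart, map_sub, h1, map_sum, Finset.sum_eq_single j]
  · simp
  · intro k _ hk
    rw [map_smul, coeff_X, if_neg, smul_zero]
    intro h
    exact hk (Sum.inr_injective (Finsupp.single_left_injective one_ne_zero h)).symm
  · simp

lemma wnorm_nonlinearPart_ne_top {F : (Fin d → ℂ) × (Fin N → ℂ) → (Fin N → ℂ)} {R : ℝ≥0}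
    {i : Fin N} (h : wnorm (radiusWeight R) (taylorSeriesXY F i) ≠ ⊤) :
    wnorm (radiusWeight R) (nonlinearPart F i) ≠ ⊤ := by
  refine ne_top_of_le_ne_top (ENNReal.add_ne_top.2 ⟨h, ?_⟩) (wnorm_sub_le _ _)
  refine ne_top_of_le_ne_top (ENNReal.sum_ne_top.2 fun j _ => ?_) (wnorm_sum_le _ _)
  rw [wnorm_smul, wnorm_X]
  exact ENNReal.mul_ne_top enorm_ne_top ENNReal.coe_ne_top

lemma formalComp_eq (F : (Fin d → ℂ) × (Fin N → ℂ) → (Fin N → ℂ))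
    {y : Fin N → MvPowerSeries (Fin d) ℂ} (hy : ∀ i, constantCoeff (y i) = 0) (i : Fin N) :
    formalComp F y i = ∑ j, jacobianY F i j • y j + subst (Sum.elim X y) (nonlinearPart F i) := by
  have hs : HasSubst (Sum.elim X y : Fin d ⊕ Fin N → MvPowerSeries (Fin d) ℂ) := by
    refine hasSubst_of_constantCoeff_zero ?_
    rintro (i | j)
    · exact constantCoeff_X _
    · exact hy j
  have h1 : subst (Sum.elim X y) (∑ j, jacobianY F i j • X (Sum.inr j) :
      MvPowerSeries (Fin d ⊕ Fin N) ℂ) = ∑ j, jacobianY F i j • y j := by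
    rw [← coe_substAlgHom hs, map_sum]
    refine Finset.sum_congr rfl fun j _ => ?_
    rw [map_smul, substAlgHom_X, Sum.elim_inr]
  rw [nonlinearPart, subst_sub hs, h1]
  exact (add_sub_cancel _ _).symm

lemma eq_sum_smul_of_eq_sum_smul {κ M : Type*} [Fintype κ] [DecidableEq κ] [AddCommGroup M]
    [Module ℂ M] {A B : Matrix κ κ ℂ} (h : B * A = 1) {u v : κ → M}
    (huv : ∀ i, u i = ∑ j, A i j • v j) (i : κ) : v i = ∑ j, B i j • u j := by
  simp only [huv, Finset.smul_sum, smul_smul]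
  rw [Finset.sum_comm]
  simp only [← Finset.sum_smul, ← Matrix.mul_apply, h, Matrix.one_apply, ite_smul, one_smul,
    zero_smul, Finset.sum_ite_eq, Finset.mem_univ, if_true]

/-- A formal solution is a fixed point of `y ↦ μ⁻¹ (P L y - G(x, y))`. -/
lemma isFormalSolution_iff (P : (Fin d → ℂ) → ℂ) (a : Fin d → (Fin d → ℂ) → ℂ)
    {F : (Fin d → ℂ) × (Fin N → ℂ) → (Fin N → ℂ)} (hμ : IsUnit (jacobianY F))
    (y : Fin N → MvPowerSeries (Fin d) ℂ) :
    IsFormalSolution P a F y ↔ (∀ i, constantCoeff (y i) = 0) ∧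
      ∀ i, y i = ∑ j, (jacobianY F)⁻¹ i j •
        (taylorSeries P * formalDerivation (fun j => taylorSeries (a j)) (y j) -
          subst (Sum.elim X y) (nonlinearPart F j)) := by
  have hdet := (Matrix.isUnit_iff_isUnit_det _).1 hμ
  constructor
  · intro hy
    refine ⟨hy.constantCoeff_eq_zero, eq_sum_smul_of_eq_sum_smul (A := jacobianY F)
      (Matrix.nonsing_inv_mul _ hdet) fun i => ?_⟩
    rw [← formalField_eq, hy.eq, formalComp_eq F hy.constantCoeff_eq_zero, add_sub_cancel_right]
  · rintro ⟨h0, hy⟩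
    refine ⟨h0, fun i => ?_⟩
    have := eq_sum_smul_of_eq_sum_smul (Matrix.mul_nonsing_inv _ hdet) hy i
    rw [formalField_eq, formalComp_eq F h0, ← this, sub_add_cancel]

/-- The Gevrey property of `∑_n y_n P^n`, from the Gevrey norm of `∑_n y_n t^n`. -/
lemma isGevreyInGerm_substTime {P : (Fin d → ℂ) → ℂ}
    (hP : constantCoeff (taylorSeries P) = 0) {ρ T C : ℝ≥0} (hρ : 0 < ρ) (hT : 0 < T)
    {Y : Fin N → MvPowerSeries (Fin d ⊕ Unit) ℂ} (hY : ∀ i, wnorm (gevreyWeight ρ T) (Y i) ≤ C) :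
    IsGevreyInGerm P 1 fun i => substTime (taylorSeries P) (Y i) := by
  have hn : ∀ n i, wnorm (radiusWeight (ρ / 2)) (timeCoeff n (Y i)) ≤
      ((2 / T) ^ n * n.factorial * C : ℝ≥0) := by
    intro n i
    refine (wnorm_timeCoeff_le hT n (Y i)).trans ?_
    rw [ENNReal.coe_mul _ C]
    gcongr
    exact hY i
  have hconv : ∀ n i, ConvergesBelow (ρ / 2) (timeCoeff n (Y i)) := fun n i =>
    convergesBelow_of_wnorm_ne_top (ne_top_of_le_ne_top ENNReal.coe_ne_top (hn n i))
  have hρ2 : 0 < ρ / 2 := half_pos hρ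
  refine ⟨fun _ => ((ρ / 2 : ℝ≥0) : ℝ), (C : ℝ) + 1, ((2 / T : ℝ≥0) : ℝ),
    fun n x i => evalSeries (timeCoeff n (Y i)) x, fun _ => by exact_mod_cast hρ2, by positivity,
    by exact_mod_cast div_pos two_pos hT, ?_, ?_, ?_⟩
  · intro n
    rw [differentiableOn_pi]
    intro i x hx
    have hx' : x ∈ Metric.ball (0 : Fin d → ℂ) ((ρ / 2 : ℝ≥0) : ℝ) := by
      rw [mem_ball_zero_iff, pi_norm_lt_iff (by exact_mod_cast hρ2)]
      exact hx
    exact ((hconv n i).hasFDerivAt hx').differentiableAt.differentiableWithinAt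
  · intro n x hx
    rw [Real.rpow_one, pi_norm_le_iff_of_nonneg (by positivity)]
    intro i
    have h1 := (enorm_evalSeries_le (R := ρ / 2) (timeCoeff n (Y i)) (x := x)
      fun i => by exact_mod_cast (hx i).le).trans (hn n i)
    rw [enorm_eq_nnnorm, ENNReal.coe_le_coe] at h1
    have h2 : ‖evalSeries (timeCoeff n (Y i)) x‖ ≤
        ((2 / T : ℝ≥0) : ℝ) ^ n * n.factorial * C := by exact_mod_cast h1
    refine h2.trans ?_
    have h3 : (0 : ℝ) ≤ ((2 / T : ℝ≥0) : ℝ) ^ n * n.factorial := by positivity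
    nlinarith
  · intro i β
    have htaylor : ∀ n, taylorSeries (fun x => evalSeries (timeCoeff n (Y i)) x) =
        timeCoeff n (Y i) := fun n => (hconv n i).taylorSeries_evalSeries hρ2
    simp only [htaylor]
    exact hasSum_coeff_substTime hP (Y i) β

end system

end GermGevrey

end

open GermGevrey

theorem theorem1 (d N : ℕ)
    (P : (Fin d → ℂ) → ℂ) (hP : AnalyticAt ℂ P 0) (hP0 : P 0 = 0)
    (hP_ne : ¬ ∀ᶠ x in 𝓝 (0 : Fin d → ℂ), P x = 0)
    (a : Fin d → (Fin d → ℂ) → ℂ) (ha : ∀ j, AnalyticAt ℂ (a j) 0)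
    (ha_ne : ∃ j, ¬ ∀ᶠ x in 𝓝 (0 : Fin d → ℂ), a j x = 0)
    (F : (Fin d → ℂ) × (Fin N → ℂ) → (Fin N → ℂ)) (hF : AnalyticAt ℂ F 0)
    (hF0 : F (0, 0) = 0) (hμ : IsUnit (jacobianY F))
    (hdvd : GermDvd P (applyField a P)) :
    (∃! y : Fin N → MvPowerSeries (Fin d) ℂ, IsFormalSolution P a F y) ∧
      ∀ y : Fin N → MvPowerSeries (Fin d) ℂ,
        IsFormalSolution P a F y → IsGevreyInGerm P 1 y := by
  obtain ⟨h, hh, hPh⟩ := hdvd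
  have hPc : constantCoeff (taylorSeries P) = 0 := by
    rw [constantCoeff_taylorSeries hP.smoothNear, hP0]
  have hL := formalDerivation_taylorSeries hP ha hh hPh
  have hG0 := constantCoeff_nonlinearPart hF hF0
  have hG1 := coeff_single_inr_nonlinearPart hF
  obtain ⟨R, hRa, hRh, hRF, hR⟩ :=
    ((Filter.eventually_all.2 fun j => eventually_wnorm_taylorSeries_ne_top (ha j)).and
      ((eventually_wnorm_taylorSeries_ne_top hh).and
        ((Filter.eventually_all.2 fun i =>
          eventually_wnorm_taylorSeries_ne_top (analyticAt_jointComponent hF i)).and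
          self_mem_nhdsWithin))).exists
  obtain ⟨ρ, T, C, hρ, hT, Y, hY0, hY, hYn⟩ := exists_gevrey_fixedPoint
    (fun j => taylorSeries (a j)) (taylorSeries h) (nonlinearPart F) (jacobianY F)⁻¹ hR hRa hRh
    (fun i => wnorm_nonlinearPart_ne_top (hRF i)) hG0 hG1
  have hsol : IsFormalSolution P a F fun i => substTime (taylorSeries P) (Y i) := by
    rw [isFormalSolution_iff P a hμ]
    exact ⟨fun i => constantCoeff_subst_eq_zero (hasSubst_elim_X hPc)
      (constantCoeff_elim_X_eq_zero hPc) (hY0 i), substTime_fixedPoint hPc _ hL _ _ hY0 hY⟩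
  have huniq : ∀ y, IsFormalSolution P a F y → y = fun i => substTime (taylorSeries P) (Y i) := by
    intro y hy
    rw [isFormalSolution_iff P a hμ] at hy hsol
    exact fixedPoint_unique hPc _ hL _ hG1 _ hy.1 hsol.1 hy.2 hsol.2
  refine ⟨⟨_, hsol, huniq⟩, fun y hy => ?_⟩
  rw [huniq y hy]
  exact isGevreyInGerm_substTime hPc hρ hT hYn
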